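/- Let $n\ge 1$ and $N\ge n+2$ be integers. Let ${\rm LC}_c(\mathbb R^n)$ be the set of functions $f=e^{-\psi}:\mathbb R^n\to[0,\infty)$, where $\psi:\mathbb R^n\to(-\infty,+\infty]$ is convex, lower semicontinuous, not identically $+\infty$, and coercive ($\psi(x)\to+\infty$ as $\|x\|\to\infty$); put $-\log f=\psi$. **Mean width.** For $f\in{\rm LC}_c(\mathbb R^n)$ let $h_f(x)=\sup_{y\in\mathbb R^n}(\langle x,y\rangle+\log f(y))$ and $w_0(f)=\frac2n\int_{\mathbb R^n}h_f\,d\gamma_n\in(-\infty,+\infty]$, where $\gamma_n$ is the standard Gaussian probability measure on $\mathbb R^n$. **Inner log-linearizations.** Given finitely many (at least one) points $(x_1,y_1),\dots,(x_k,y_k)$ in the epigraph $\{(x,t)\in\mathbb R^n\times\mathbb R:\psi(x)\le t\}$ of $\psi=-\log f$, the corresponding inner linearization of $\psi$ is $p(x)=\min\{\sum_i\lambda_iy_i:\lambda_i\ge0,\ \sum_i\lambda_i=1,\ \sum_i\lambda_ix_i=x\}$, with $p(x)=+\infty$ if $x\notin{\rm conv}\{x_1,\dots,x_k\}$. A break point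 of $p$ is a point $x$ such that $(x,y)$ is an extreme point of the epigraph of $p$ for some $y\in\mathbb R$. Let $\mathscr P_N(f)$ be the set of all $q=e^{-p}$ with $p$ an inner linearization of $-\log f$ having at most $N$ break points, and $$G_N(f)=\sup_{q\in\mathscr P_N(f)}w_0(q)\in(-\infty,+\infty].$$ **Hypo-symmetrization.** For a unit vector $u$, let $R_u$ be the reflection about $u^\perp$ and let $(\tau_uf)(x)=\sup_{y+z=x}\sqrt{f(2y)\,f(R_u(2z))}$ be the Minkowski symmetral of $f$. A sequence $f_j=e^{-\psi_j}$ hypo-converges to $g=e^{-\varphi}$ if for every $x$ one has $\varphi(x)\le\liminf_j\psi_j(x_j)$ for all sequences $x_j\to x$, and $\varphi(x)=\lim_j\psi_j(x_j)$ for at least one sequence $x_j\to x$. A hypo-symmetrization $f_{\rm sym}$ of $f$ is a function in ${\rm LC}_c(\mathbb R^n)$ that is invariant under all linear isometries of $\mathbb R^n$ and is the hypo-limit, as $m\to\infty$, of $\tau_{u_m}\cdots\tau_{u_1}f$ for some sequence of unit vectors $(u_i)$. **Theorem.** Every $f\in{\rm LC}_c(\mathbb R^n)$ has a hypo-symmetrization,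 and for every hypo-symmetrization $f_{\rm sym}$ of $f$, $$G_N(f)\ \ge\ G_N(f_{\rm sym}).$$ -/

import Mathlib

open MeasureTheory ProbabilityTheory Filter Topology
open scoped ENNReal InnerProductSpace

namespace HypoSym

/-- `ℝⁿ` with the Euclidean inner product. -/
abbrev E (n : ℕ) : Type := EuclideanSpace ℝ (Fin n)

/-! ### Convex functions with values in `[-∞, ∞]` and log-concave functions -/

/-- The epigraph `{(x, t) ∈ ℝⁿ × ℝ : ψ x ≤ t}`. -/
def epi {n : ℕ} (ψ : E n → EReal) : Set (E n × ℝ) :=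
  {p | ψ p.1 ≤ (p.2 : EReal)}

/-- `Conv_c(ℝⁿ)`: convex, coercive, proper, lower semicontinuous functions.
An extended-real valued function is convex when its epigraph is convex. -/
structure IsConvC {n : ℕ} (ψ : E n → EReal) : Prop where
  convex : Convex ℝ (epi ψ)
  coercive : Tendsto ψ (Bornology.cobounded (E n)) (𝓝 ⊤)
  proper : ∃ x, ψ x < ⊤
  lsc : LowerSemicontinuous ψ

/-- `LC_c(ℝⁿ)`: functions `f : ℝⁿ → [0, ∞)` of the form `f = e^{-ψ}` with `ψ ∈ Conv_c(ℝⁿ)`. -/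
def IsLCc {n : ℕ} (f : E n → ℝ≥0∞) : Prop :=
  (∀ x, f x ≠ ∞) ∧ ∃ ψ : E n → EReal, IsConvC ψ ∧ ∀ x, f x = EReal.exp (-ψ x)

/-- The base function `-log f` (with `-log 0 = +∞`), so that `f = e^{-base f}`. -/
noncomputable def base {n : ℕ} (f : E n → ℝ≥0∞) : E n → EReal :=
  fun x => -ENNReal.log (f x)

/-! ### Mean width -/

/-- The Legendre-Fenchel conjugate `(ℒψ)(x) = sup_y (⟨x, y⟩ - ψ(y))`. -/
noncomputable def conjugate {n : ℕ} (ψ : E n → EReal) : E n → EReal :=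
  fun x => ⨆ y : E n, ((⟪x, y⟫_ℝ : ℝ) : EReal) - ψ y

/-- The support function `h_f = ℒ(-log f)`. -/
noncomputable def supportFun {n : ℕ} (f : E n → ℝ≥0∞) : E n → EReal :=
  conjugate (base f)

/-- The integral of an extended-real valued function, as the integral of the positive part minus
the integral of the negative part. -/
noncomputable def erealIntegral {α : Type*} [MeasurableSpace α] (μ : Measure α)
    (h : α → EReal) : EReal :=
  ((∫⁻ x, (h x).toENNReal ∂μ : ℝ≥0∞) : EReal) - ((∫⁻ x, (-h x).toENNReal ∂μ : ℝ≥0∞) : EReal)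

/-- The Gaussian mean width `w₀(f) = (2/n) ∫ h_f dγ_n`, with `γ_n` the standard Gaussian
probability measure on `ℝⁿ`. -/
noncomputable def meanWidth {n : ℕ} (f : E n → ℝ≥0∞) : EReal :=
  ((2 / (n : ℝ) : ℝ) : EReal) * erealIntegral (stdGaussian (E n)) (supportFun f)

/-! ### Inner (log-)linearizations -/

/-- The inner linearization determined by the points `X i = (xᵢ, yᵢ)`: its value at `x` is the
minimum of `∑ λᵢ yᵢ` over all convex weights `λ` with `∑ λᵢ xᵢ = x`, and `+∞` if there are none. -/
noncomputable def innerLin {n k : ℕ} (X : Fin k → E n × ℝ) : E n → EReal :=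
  fun x => ⨅ (l : Fin k → ℝ) (_ : l ∈ stdSimplex ℝ (Fin k)) (_ : ∑ i, l i • (X i).1 = x),
    ((∑ i, l i * (X i).2 : ℝ) : EReal)

/-- The break points of `p`: the points `x` over which the epigraph of `p` has an extreme point. -/
def breakPoints {n : ℕ} (p : E n → EReal) : Set (E n) :=
  {x | ∃ y : ℝ, (x, y) ∈ (epi p).extremePoints ℝ}

/-- `𝒞_N(ψ)`: inner linearizations, determined by a finite nonempty family of points of the
epigraph of `ψ`, with at most `N` break points. -/
def innerLinearizations {n : ℕ} (N : ℕ) (ψ : E n → EReal) : Set (E n → EReal) :=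
  {p | (∃ (k : ℕ) (X : Fin k → E n × ℝ), 0 < k ∧ (∀ i, X i ∈ epi ψ) ∧ p = innerLin X) ∧
    (breakPoints p).encard ≤ N}

/-- `𝒫_N(f) = {e^{-p} : p ∈ 𝒞_N(-log f)}`: inner log-linearizations with at most `N` break
points. -/
def innerLogLinearizations {n : ℕ} (N : ℕ) (f : E n → ℝ≥0∞) : Set (E n → ℝ≥0∞) :=
  {q | ∃ p ∈ innerLinearizations N (base f), q = fun x => EReal.exp (-p x)}

/-- `G_N(f) = sup {w₀(q) : q ∈ 𝒫_N(f)}`, a supremum in `[-∞, ∞]`. -/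
noncomputable def G {n : ℕ} (N : ℕ) (f : E n → ℝ≥0∞) : EReal :=
  ⨆ q ∈ innerLogLinearizations N f, meanWidth q

/-! ### Minkowski symmetrization and hypo-symmetrization -/

/-- The Asplund sum `(f ⋆ g)(x) = sup_{y+z=x} f(y) g(z)`. -/
noncomputable def asplund {n : ℕ} (f g : E n → ℝ≥0∞) : E n → ℝ≥0∞ :=
  fun x => ⨆ (y : E n) (z : E n) (_ : y + z = x), f y * g z

/-- The homothety `(λ · f)(x) = f(x / λ) ^ λ`. -/
noncomputable def homothety {n : ℕ} (l : ℝ) (f : E n → ℝ≥0∞) : E n → ℝ≥0∞ :=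
  fun x => f (l⁻¹ • x) ^ l

/-- The reflection `R_u f` of `f` about the hyperplane `u^⊥`. -/
noncomputable def reflectFun {n : ℕ} (u : E n) (f : E n → ℝ≥0∞) : E n → ℝ≥0∞ :=
  fun x => f ((Submodule.span ℝ {u})ᗮ.reflection x)

/-- The Minkowski symmetral `τ_u f = ½ · f ⋆ ½ · R_u f`. -/
noncomputable def minkSym {n : ℕ} (u : E n) (f : E n → ℝ≥0∞) : E n → ℝ≥0∞ :=
  asplund (homothety (1 / 2) f) (homothety (1 / 2) (reflectFun u f))

/-- Successive Minkowski symmetrizations of `f` in the directions `u 0, …, u (m - 1)`. -/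
noncomputable def iterSym {n : ℕ} (u : ℕ → E n) (f : E n → ℝ≥0∞) : ℕ → (E n → ℝ≥0∞)
  | 0 => f
  | m + 1 => minkSym (u m) (iterSym u f m)

/-- Epi-convergence of a sequence of extended-real valued functions. -/
def EpiConverges {n : ℕ} (ψ : ℕ → E n → EReal) (φ : E n → EReal) : Prop :=
  ∀ x : E n,
    (∀ s : ℕ → E n, Tendsto s atTop (𝓝 x) → φ x ≤ liminf (fun j => ψ j (s j)) atTop) ∧
    ∃ s : ℕ → E n, Tendsto s atTop (𝓝 x) ∧ Tendsto (fun j => ψ j (s j)) atTop (𝓝 (φ x))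

/-- Hypo-convergence `e^{-ψ_j} → e^{-φ}`: epi-convergence of the base functions. -/
def HypoConverges {n : ℕ} (f : ℕ → E n → ℝ≥0∞) (g : E n → ℝ≥0∞) : Prop :=
  EpiConverges (fun j => base (f j)) (base g)

/-- `g` is the hypo-symmetrization `f_sym` of `f`: the rotation-invariant member of `LC_c(ℝⁿ)`
which is the hypo-limit of a sequence of successive Minkowski symmetrizations of `f`. -/
structure IsHypoSymmetrization {n : ℕ} (f g : E n → ℝ≥0∞) : Prop where
  mem : IsLCc g
  rotation_invariant : ∀ (T : E n ≃ₗᵢ[ℝ] E n) (x : E n), g (T x) = g x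
  limit : ∃ u : ℕ → E n, (∀ i, ‖u i‖ = 1) ∧ HypoConverges (iterSym u f) g

end HypoSym

namespace HypoSym

/-! For the inequality, `G_le_iff` turns `G N f` into a supremum of `gaussWidth X = ∫ max_i (⟨x, xᵢ⟩
- yᵢ) dγ` over families of at most `N` points of the epigraph. If every point of `X` is the
symmetrized average of a point of `A` and a point of `B`, then `maxAff X ≤ (maxAff A + maxAff B ∘
R_u) / 2` pointwise. Reflection invariance of `γ` then gives `gaussWidth X ≤ (gaussWidth A +
gaussWidth B) / 2` (`gaussWidth_symm_le`). The number of points does not grow, so a bound for `f`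
passes to every iterated symmetral, and recovery sequences carry it to the hypo-limit, since
`gaussWidth` is stable under small displacements of the points.

For existence, pass to support functions: one symmetrization replaces `h` by `(h + h ∘ R_u) / 2`.
Along a sequence of directions that keeps returning to finite nets of the sphere, the oscillation of
these averages on each sphere contracts geometrically (`OscLe.contract`). So they converge to a
radial function `b`, uniformly on smaller balls, on the union of the centred open balls in the
domain of `h`. The limit function is the conjugate of `b`.

The lower half of epi-convergence comes from affine minorants. For recovery sequences
(`IsAvgLimit.eventually_exists_mem`), an epigraph missing a small cylinder around the limit point
would be separated from it by some slope `y`. Uniform convergence excludes small `y`. Larger `y` are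
scaled back into the ball by convexity, at a small cost because the domains shrink to almost that
ball. -/

/-- The reflection about the hyperplane `u^⊥`. -/
noncomputable abbrev refl {n : ℕ} (u : E n) : E n ≃ₗᵢ[ℝ] E n :=
  (Submodule.span ℝ {u})ᗮ.reflection

lemma refl_refl {n : ℕ} (u x : E n) : refl u (refl u x) = x :=
  Submodule.reflection_reflection _ x

lemma inner_refl_left {n : ℕ} (u x y : E n) : ⟪refl u x, y⟫_ℝ = ⟪x, refl u y⟫_ℝ := by
  rw [← (refl u).inner_map_map x (refl u y), refl_refl]

/-! ### Symmetrization of epigraphs -/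

/-- The Minkowski symmetral of a subset of `ℝⁿ × ℝ` with respect to `u^⊥ × ℝ`. -/
def symSet {n : ℕ} (u : E n) (K : Set (E n × ℝ)) : Set (E n × ℝ) :=
  {p | ∃ a ∈ K, ∃ b ∈ K, p = ((1 / 2 : ℝ) • (a.1 + refl u b.1), (a.2 + b.2) / 2)}

/-- Successive Minkowski symmetrals of the epigraph of `-log f`. -/
def epiSeq {n : ℕ} (u : ℕ → E n) (f : E n → ℝ≥0∞) : ℕ → Set (E n × ℝ)
  | 0 => epi (base f)
  | m + 1 => symSet (u m) (epiSeq u f m)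

lemma base_le_iff {n : ℕ} (f : E n → ℝ≥0∞) (x : E n) (t : ℝ) :
    base f x ≤ (t : EReal) ↔ ENNReal.ofReal (Real.exp (-t)) ≤ f x := by
  rw [base, EReal.neg_le, ← EReal.exp_le_exp_iff, ENNReal.exp_log, ← EReal.coe_neg,
    EReal.exp_coe]

lemma base_lt_iff {n : ℕ} (f : E n → ℝ≥0∞) (x : E n) (t : ℝ) :
    base f x < (t : EReal) ↔ ENNReal.ofReal (Real.exp (-t)) < f x := by
  rw [base, EReal.neg_lt_comm, ← EReal.exp_lt_exp_iff, ENNReal.exp_log, ← EReal.coe_neg,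
    EReal.exp_coe]

lemma ofReal_exp_rpow (s c : ℝ) :
    ENNReal.ofReal (Real.exp s) ^ c = ENNReal.ofReal (Real.exp (s * c)) := by
  rw [ENNReal.ofReal_rpow_of_pos (Real.exp_pos _), Real.exp_mul]

lemma minkSym_eq {n : ℕ} (u : E n) (f : E n → ℝ≥0∞) (x : E n) :
    minkSym u f x = ⨆ (y : E n) (z : E n) (_ : y + z = x),
      f ((2 : ℝ) • y) ^ (1 / 2 : ℝ) * f (refl u ((2 : ℝ) • z)) ^ (1 / 2 : ℝ) := by
  simp [minkSym, asplund, homothety, reflectFun]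

lemma symSet_epi_subset {n : ℕ} (u : E n) (f : E n → ℝ≥0∞) :
    symSet u (epi (base f)) ⊆ epi (base (minkSym u f)) := by
  rintro p ⟨a, ha, b, hb, rfl⟩
  simp only [epi, Set.mem_ofPred_eq, base_le_iff] at ha hb ⊢
  rw [minkSym_eq]
  refine le_iSup_of_le ((1 / 2 : ℝ) • a.1) (le_iSup_of_le ((1 / 2 : ℝ) • refl u b.1)
    (le_iSup_of_le (by rw [smul_add]) ?_))
  have e1 : (2 : ℝ) • (1 / 2 : ℝ) • a.1 = a.1 := by rw [smul_smul]; norm_num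
  have e2 : (2 : ℝ) • (1 / 2 : ℝ) • refl u b.1 = refl u b.1 := by rw [smul_smul]; norm_num
  rw [e1, e2, refl_refl]
  calc ENNReal.ofReal (Real.exp (-((a.2 + b.2) / 2)))
      = ENNReal.ofReal (Real.exp (-a.2)) ^ (1 / 2 : ℝ) *
          ENNReal.ofReal (Real.exp (-b.2)) ^ (1 / 2 : ℝ) := by
        rw [ofReal_exp_rpow, ofReal_exp_rpow, ← ENNReal.ofReal_mul (Real.exp_pos _).le,
          ← Real.exp_add]
        congr 2; ring
    _ ≤ _ := by gcongr

/-- Strictness leaves room: any `e^{-s}` strictly between `e^{-2t} / q` and `p` works, with `r = 2t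
- s`. -/
lemma exists_real_lt_mul {p q : ℝ≥0∞} {t : ℝ}
    (h : ENNReal.ofReal (Real.exp (-t)) < p ^ (1 / 2 : ℝ) * q ^ (1 / 2 : ℝ)) :
    ∃ s r : ℝ, ENNReal.ofReal (Real.exp (-s)) < p ∧ ENNReal.ofReal (Real.exp (-r)) < q ∧
      (s + r) / 2 = t := by
  rw [← ENNReal.mul_rpow_of_nonneg _ _ (by norm_num : (0 : ℝ) ≤ 1 / 2)] at h
  have h2 : ENNReal.ofReal (Real.exp (-(2 * t))) < p * q := by
    have := ENNReal.rpow_lt_rpow h (by norm_num : (0 : ℝ) < 2)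
    rw [ofReal_exp_rpow, ← ENNReal.rpow_mul] at this
    norm_num at this
    convert this using 3
    ring
  have hp : p ≠ 0 := by rintro rfl; simp at h2
  have hq : q ≠ 0 := by rintro rfl; simp at h2
  obtain ⟨s, hs1, hs2⟩ : ∃ s : ℝ, ENNReal.ofReal (Real.exp (-s)) < p ∧
      ENNReal.ofReal (Real.exp (-(2 * t))) < ENNReal.ofReal (Real.exp (-s)) * q := by
    have hlt : ENNReal.ofReal (Real.exp (-(2 * t))) / q < p :=
      ENNReal.div_lt_of_lt_mul h2
    obtain ⟨p', h1, h2'⟩ := exists_between hlt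
    have hp0 : p' ≠ 0 := (zero_le.trans_lt h1).ne'
    have hpt : p' ≠ ∞ := (h2'.trans_le le_top).ne
    have hp' : ENNReal.ofReal (Real.exp (-(-Real.log p'.toReal))) = p' := by
      rw [neg_neg, Real.exp_log (ENNReal.toReal_pos hp0 hpt), ENNReal.ofReal_toReal hpt]
    refine ⟨-Real.log p'.toReal, by rwa [hp'], ?_⟩
    rw [hp']
    rwa [ENNReal.div_lt_iff (Or.inl hq) (Or.inr (by simp))] at h1
  refine ⟨s, 2 * t - s, hs1, ?_, by ring⟩
  have : ENNReal.ofReal (Real.exp (-(2 * t))) =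
      ENNReal.ofReal (Real.exp (-s)) * ENNReal.ofReal (Real.exp (-(2 * t - s))) := by
    rw [← ENNReal.ofReal_mul (Real.exp_pos _).le, ← Real.exp_add]; congr 2; ring
  rw [this] at hs2
  exact (ENNReal.mul_lt_mul_iff_right (by simp [Real.exp_pos]) (by simp)).1 hs2

lemma symSet_mono {n : ℕ} (u : E n) {K L : Set (E n × ℝ)} (h : K ⊆ L) :
    symSet u K ⊆ symSet u L := by
  rintro p ⟨a, ha, b, hb, rfl⟩
  exact ⟨a, h ha, b, h hb, rfl⟩

lemma mem_symSet_of_minkSym_lt {n : ℕ} {u : E n} {f : E n → ℝ≥0∞} {K : Set (E n × ℝ)}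
    (hK : ∀ x (t : ℝ), base f x < t → (x, t) ∈ K) {x : E n} {t : ℝ}
    (h : base (minkSym u f) x < t) : (x, t) ∈ symSet u K := by
  rw [base_lt_iff, minkSym_eq] at h
  simp only [lt_iSup_iff] at h
  obtain ⟨y, z, rfl, h⟩ := h
  obtain ⟨s, r, hs, hr, rfl⟩ := exists_real_lt_mul h
  refine ⟨_, hK _ s ((base_lt_iff _ _ _).2 hs), _, hK _ r ((base_lt_iff _ _ _).2 hr), ?_⟩
  simp only [refl_refl, ← smul_add, smul_smul]
  norm_num

/-- The supremum in `minkSym` need not be attained, so `epiSeq` is only squeezed between the strict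
epigraph (`mem_epiSeq_of_lt`) and the epigraph of the iterate. Limit arguments lose nothing by this.
-/
lemma epiSeq_subset {n : ℕ} (u : ℕ → E n) (f : E n → ℝ≥0∞) (m : ℕ) :
    epiSeq u f m ⊆ epi (base (iterSym u f m)) := by
  induction m with
  | zero => exact subset_rfl
  | succ m ih => exact (symSet_mono _ ih).trans (symSet_epi_subset _ _)

lemma mem_epiSeq_of_lt {n : ℕ} (u : ℕ → E n) (f : E n → ℝ≥0∞) (m : ℕ) :
    ∀ x (t : ℝ), base (iterSym u f m) x < t → (x, t) ∈ epiSeq u f m := by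
  induction m with
  | zero => exact fun x t h => h.le
  | succ m ih => exact fun x t h => mem_symSet_of_minkSym_lt ih h

lemma convex_symSet {n : ℕ} (u : E n) {K : Set (E n × ℝ)} (hK : Convex ℝ K) :
    Convex ℝ (symSet u K) := by
  rintro _ ⟨a, ha, b, hb, rfl⟩ _ ⟨c, hc, d, hd, rfl⟩ s t hs ht hst
  refine ⟨_, hK ha hc hs ht hst, _, hK hb hd hs ht hst, ?_⟩
  ext1
  · simp only [Prod.fst_add, Prod.smul_fst, map_add, map_smul]
    module
  · simp only [Prod.snd_add, Prod.smul_snd, smul_eq_mul]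
    ring

/-! ### Inner linearizations -/

lemma innerLin_le {n k : ℕ} (X : Fin k → E n × ℝ) {l : Fin k → ℝ}
    (hl : l ∈ stdSimplex ℝ (Fin k)) :
    innerLin X (∑ i, l i • (X i).1) ≤ ((∑ i, l i * (X i).2 : ℝ) : EReal) :=
  iInf_le_of_le l (iInf_le_of_le hl (iInf_le_of_le rfl le_rfl))

/-- The admissible weights form a compact set, so the infimum is attained whenever it is not `⊤`. -/
lemma mem_epi_innerLin {n k : ℕ} (X : Fin k → E n × ℝ) (p : E n × ℝ) :
    p ∈ epi (innerLin X) ↔ ∃ l ∈ stdSimplex ℝ (Fin k), ∑ i, l i • (X i).1 = p.1 ∧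
      ∑ i, l i * (X i).2 ≤ p.2 := by
  constructor
  · intro hp
    change innerLin X p.1 ≤ (p.2 : EReal) at hp
    let C : Set (Fin k → ℝ) := {l | l ∈ stdSimplex ℝ (Fin k) ∧ ∑ i, l i • (X i).1 = p.1}
    have hCc : IsCompact C := (isCompact_stdSimplex ℝ (Fin k)).inter_right
      (isClosed_eq (by fun_prop) continuous_const)
    have hne : C.Nonempty := by
      by_contra hC
      have htop : innerLin X p.1 = ⊤ := by
        simp only [innerLin, iInf_eq_top]
        exact fun l hl hx => absurd ⟨l, hl, hx⟩ hC
      rw [htop] at hp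
      exact absurd hp (by simp)
    obtain ⟨l, hl, hmin⟩ := hCc.exists_isMinOn hne
      (f := fun l : Fin k → ℝ => ∑ i, l i * (X i).2) (by fun_prop)
    refine ⟨l, hl.1, hl.2, ?_⟩
    have hle : ((∑ i, l i * (X i).2 : ℝ) : EReal) ≤ innerLin X p.1 :=
      le_iInf fun w => le_iInf fun hw => le_iInf fun hx =>
        EReal.coe_le_coe_iff.2 (hmin (show w ∈ C from ⟨hw, hx⟩))
    exact EReal.coe_le_coe_iff.1 (hle.trans hp)
  · rintro ⟨l, hl, h1, h2⟩
    change innerLin X p.1 ≤ (p.2 : EReal)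
    rw [← h1]
    exact (innerLin_le X hl).trans (EReal.coe_le_coe_iff.2 h2)

lemma single_mem_epi {n k : ℕ} (X : Fin k → E n × ℝ) (i : Fin k) : X i ∈ epi (innerLin X) := by
  rw [mem_epi_innerLin]
  exact ⟨Pi.single i 1, single_mem_stdSimplex ℝ i, by simp [Pi.single_apply],
    by simp [Pi.single_apply]⟩

lemma convex_epi_innerLin {n k : ℕ} (X : Fin k → E n × ℝ) : Convex ℝ (epi (innerLin X)) := by
  intro p hp q hq a b ha hb hab
  rw [mem_epi_innerLin] at hp hq ⊢
  obtain ⟨l, hl, h1, h2⟩ := hp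
  obtain ⟨w, hw, h3, h4⟩ := hq
  refine ⟨a • l + b • w, convex_stdSimplex ℝ _ hl hw ha hb hab, ?_, ?_⟩
  · simp only [Pi.add_apply, Pi.smul_apply, smul_eq_mul, add_smul, mul_smul,
      Finset.sum_add_distrib, ← Finset.smul_sum, h1, h3, Prod.fst_add, Prod.smul_fst]
  · simp only [Pi.add_apply, Pi.smul_apply, smul_eq_mul, add_mul, mul_assoc,
      Finset.sum_add_distrib, ← Finset.mul_sum, Prod.snd_add, Prod.smul_snd]
    gcongr

/-- An extreme point of the epigraph lies on the graph, hence in the convex hull of the `X i`; it is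
extreme there too, hence one of them. -/
lemma breakPoints_innerLin_subset {n k : ℕ} (X : Fin k → E n × ℝ) :
    breakPoints (innerLin X) ⊆ Set.range fun i => (X i).1 := by
  rintro x ⟨t, ht⟩
  have hmem := (mem_extremePoints.1 ht).1
  obtain ⟨l, hl, h1, h2⟩ := (mem_epi_innerLin X _).1 hmem
  set s := ∑ i, l i * (X i).2 with hs
  simp only at h1 h2
  have hst : s = t := by
    have hseg : ((x, t) : E n × ℝ) ∈ openSegment ℝ (x, s) (x, 2 * t - s) := by
      refine ⟨1 / 2, 1 / 2, by norm_num, by norm_num, by norm_num, ?_⟩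
      ext1
      · simp only [Prod.fst_add, Prod.smul_fst]; module
      · simp only [Prod.snd_add, Prod.smul_snd, smul_eq_mul]; ring
    have := ((mem_extremePoints.1 ht).2 (x, s) ((mem_epi_innerLin X _).2 ⟨l, hl, h1, le_rfl⟩)
      (x, 2 * t - s) ((mem_epi_innerLin X _).2 ⟨l, hl, h1, by simp only; linarith⟩) hseg).1
    exact congrArg Prod.snd this
  have hhull : ((x, t) : E n × ℝ) ∈ convexHull ℝ (Set.range X) := by
    refine mem_convexHull_of_exists_fintype l X hl.1 hl.2 (fun i => ⟨i, rfl⟩) ?_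
    ext1
    · simpa [Prod.fst_sum] using h1
    · simpa [Prod.snd_sum, hs] using hst
  have hsub : convexHull ℝ (Set.range X) ⊆ epi (innerLin X) :=
    convexHull_min (by rintro _ ⟨i, rfl⟩; exact single_mem_epi X i) (convex_epi_innerLin X)
  obtain ⟨i, hi⟩ := extremePoints_convexHull_subset
    (inter_extremePoints_subset_extremePoints_of_subset hsub ⟨hhull, ht⟩)
  exact ⟨i, by simp [hi]⟩

/-- The weight of a redundant point can be redistributed over the others according to `l` without
raising the height. -/
lemma innerLin_succAbove {n k : ℕ} (X : Fin (k + 1) → E n × ℝ) (i : Fin (k + 1))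
    {l : Fin (k + 1) → ℝ} (hl : l ∈ stdSimplex ℝ (Fin (k + 1))) (hi : l i = 0)
    (h1 : ∑ j, l j • (X j).1 = (X i).1) (h2 : ∑ j, l j * (X j).2 ≤ (X i).2) :
    innerLin X = innerLin fun j => X (i.succAbove j) := by
  have hs := hl.2
  rw [Fin.sum_univ_succAbove _ i, hi] at hs h1 h2
  simp only [zero_add, zero_smul, zero_mul] at hs h1 h2
  funext x
  apply le_antisymm
  · refine le_iInf fun w => le_iInf fun hw => le_iInf fun hx => ?_
    refine iInf_le_of_le (i.insertNth 0 w) (iInf_le_of_le ⟨fun j => ?_, ?_⟩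
      (iInf_le_of_le ?_ ?_))
    · cases j using i.succAboveCases with
      | x => simp
      | p j => simpa using hw.1 j
    · rw [Fin.sum_univ_succAbove _ i]; simpa using hw.2
    · rw [Fin.sum_univ_succAbove _ i]; simpa using hx
    · rw [Fin.sum_univ_succAbove _ i]; simp
  · refine le_iInf fun w => le_iInf fun hw => le_iInf fun hx => ?_
    have hw2 := hw.2
    rw [Fin.sum_univ_succAbove _ i] at hw2 hx ⊢
    refine iInf_le_of_le (fun j => w (i.succAbove j) + w i * l (i.succAbove j))
      (iInf_le_of_le ⟨fun j => ?_, ?_⟩ (iInf_le_of_le ?_ ?_))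
    · exact add_nonneg (hw.1 _) (mul_nonneg (hw.1 _) (hl.1 _))
    · rw [Finset.sum_add_distrib, ← Finset.mul_sum, hs]; linarith
    · simp only [add_smul, mul_smul, Finset.sum_add_distrib, ← Finset.smul_sum, h1]
      rw [← hx, add_comm]
    · simp only [add_mul, mul_assoc, Finset.sum_add_distrib, ← Finset.mul_sum]
      rw [EReal.coe_le_coe_iff, add_comm]
      gcongr
      exact hw.1 i

/-- A segment through `X i` yields weights `a * l + b * w` representing it. If some weight falls on
other points, removing `i` and renormalizing makes `X i` redundant; otherwise both endpoints lie on
the vertical ray above `X i`, and so equal it. -/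
lemma mem_extremePoints_of_not_redundant {n k : ℕ} (X : Fin k → E n × ℝ) (i : Fin k)
    (h : ∀ l ∈ stdSimplex ℝ (Fin k), l i = 0 → ∑ j, l j • (X j).1 = (X i).1 →
      ¬ ∑ j, l j * (X j).2 ≤ (X i).2) :
    X i ∈ (epi (innerLin X)).extremePoints ℝ := by
  rw [mem_extremePoints]
  refine ⟨single_mem_epi X i, fun p hp q hq => ?_⟩
  rintro ⟨a, b, ha, hb, hab, hpq⟩
  obtain ⟨l, hl, hl1, hl2⟩ := (mem_epi_innerLin X _).1 hp
  obtain ⟨w, hw, hw1, hw2⟩ := (mem_epi_innerLin X _).1 hq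
  have hX1 : a • p.1 + b • q.1 = (X i).1 := congrArg Prod.fst hpq
  have hX2 : a * p.2 + b * q.2 = (X i).2 := congrArg Prod.snd hpq
  have hli : l i ≤ 1 := hl.2 ▸ Finset.single_le_sum (fun j _ => hl.1 j) (Finset.mem_univ i)
  have hwi : w i ≤ 1 := hw.2 ▸ Finset.single_le_sum (fun j _ => hw.1 j) (Finset.mem_univ i)
  set c := 1 - (a * l i + b * w i) with hc
  have hc0 : 0 ≤ c := by nlinarith
  rcases hc0.lt_or_eq with hc0 | hc0
  · exfalso
    have e1 : ∑ j, (a * l j + b * w j) • (X j).1 = (X i).1 := by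
      simp only [add_smul, mul_smul, Finset.sum_add_distrib, ← Finset.smul_sum, hl1, hw1, hX1]
    have e2 : ∑ j, (a * l j + b * w j) * (X j).2 ≤ (X i).2 := by
      simp only [add_mul, mul_assoc, Finset.sum_add_distrib, ← Finset.mul_sum]
      rw [← hX2]
      gcongr
    have e3 : ∑ j, (a * l j + b * w j) = 1 := by
      simp only [Finset.sum_add_distrib, ← Finset.mul_sum, hl.2, hw.2]; linarith
    let v : Fin k → ℝ := fun j => if j = i then 0 else c⁻¹ * (a * l j + b * w j)
    have hv : ∀ j, v j = c⁻¹ * (a * l j + b * w j) -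
        (if j = i then c⁻¹ * (a * l i + b * w i) else 0) := by
      intro j
      by_cases hj : j = i
      · subst hj; simp [v]
      · simp [v, hj]
    refine h v ⟨fun j => ?_, ?_⟩ (by simp [v]) ?_ ?_
    · simp only [v]
      split_ifs
      · exact le_rfl
      · exact mul_nonneg (inv_nonneg.2 hc0.le)
          (add_nonneg (mul_nonneg ha.le (hl.1 j)) (mul_nonneg hb.le (hw.1 j)))
    · simp only [hv, Finset.sum_sub_distrib, ← Finset.mul_sum, e3, Finset.sum_ite_eq',
        Finset.mem_univ, if_true]
      rw [← mul_sub, ← hc, inv_mul_cancel₀ hc0.ne']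
    · simp only [hv, sub_smul, Finset.sum_sub_distrib, mul_smul, ← Finset.smul_sum, e1, ite_smul,
        zero_smul, Finset.sum_ite_eq', Finset.mem_univ, if_true]
      rw [← smul_sub, inv_smul_eq_iff₀ hc0.ne', hc, sub_smul, one_smul]
    · simp only [hv, sub_mul, Finset.sum_sub_distrib, mul_assoc, ← Finset.mul_sum, ite_mul,
        zero_mul, Finset.sum_ite_eq', Finset.mem_univ, if_true]
      rw [← mul_sub, inv_mul_le_iff₀ hc0, hc, sub_mul, one_mul]
      gcongr
  · have hl' : l i = 1 := by nlinarith
    have hw' : w i = 1 := by nlinarith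
    have key : ∀ v ∈ stdSimplex ℝ (Fin k), v i = 1 → v = Pi.single i 1 := by
      intro v hv hvi
      have hz : ∑ j ∈ Finset.univ.erase i, v j = 0 := by
        have := Finset.add_sum_erase Finset.univ v (Finset.mem_univ i)
        rw [hv.2, hvi] at this
        linarith
      rw [Finset.sum_eq_zero_iff_of_nonneg (fun j _ => hv.1 j)] at hz
      funext j
      by_cases hj : j = i
      · subst hj; simp [hvi]
      · simp [hj, hz j (by simp [hj])]
    rw [key l hl hl'] at hl1 hl2
    rw [key w hw hw'] at hw1 hw2
    simp only [Pi.single_apply, ite_smul, one_smul, zero_smul, Finset.sum_ite_eq',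
      Finset.mem_univ, if_true, ite_mul, one_mul, zero_mul] at hl1 hl2 hw1 hw2
    have hz : a * (p.2 - (X i).2) + b * (q.2 - (X i).2) = 0 := by
      linear_combination hX2 - (X i).2 * hab
    have hz1 := mul_nonneg ha.le (sub_nonneg.2 hl2)
    have hz2 := mul_nonneg hb.le (sub_nonneg.2 hw2)
    have e1 : p.2 = (X i).2 :=
      sub_eq_zero.1 ((mul_eq_zero.1 (by linarith : a * (p.2 - (X i).2) = 0)).resolve_left ha.ne')
    have e2 : q.2 = (X i).2 :=
      sub_eq_zero.1 ((mul_eq_zero.1 (by linarith : b * (q.2 - (X i).2) = 0)).resolve_left hb.ne')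
    exact ⟨Prod.ext hl1.symm e1, Prod.ext hw1.symm e2⟩

/-- An inner linearization is determined by points lying over pairwise distinct break points. -/
lemma exists_innerLin_card_le {n k : ℕ} {K : Set (E n × ℝ)} (hk : 0 < k) (X : Fin k → E n × ℝ)
    (hX : ∀ i, X i ∈ K) :
    ∃ (m : ℕ) (Y : Fin m → E n × ℝ), 0 < m ∧ (∀ i, Y i ∈ K) ∧ innerLin X = innerLin Y ∧
      (m : ℕ∞) ≤ (breakPoints (innerLin X)).encard := by
  classical
  -- In a generating family of least cardinality no point is redundant, so all of them are extreme.
  have hex : ∃ m, ∃ Y : Fin m → E n × ℝ, 0 < m ∧ (∀ i, Y i ∈ K) ∧ innerLin X = innerLin Y :=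
    ⟨k, X, hk, hX, rfl⟩
  obtain ⟨Y, hm, hY, he⟩ := Nat.find_spec hex
  have hmin := fun j => Nat.find_min hex (m := j)
  generalize Nat.find hex = m at Y hm hY he hmin
  refine ⟨m, Y, hm, hY, he, ?_⟩
  have hred : ∀ i, ∀ l ∈ stdSimplex ℝ (Fin m), l i = 0 → ∑ j, l j • (Y j).1 = (Y i).1 →
      ¬ ∑ j, l j * (Y j).2 ≤ (Y i).2 := by
    intro i l hl hi h1 h2
    obtain ⟨j, rfl⟩ : ∃ j, m = j + 1 := ⟨m - 1, by omega⟩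
    refine hmin j (by omega) ⟨fun r => Y (i.succAbove r), ?_, fun r => hY _,
      he.trans (innerLin_succAbove Y i hl hi h1 h2)⟩
    rcases Nat.eq_zero_or_pos j with rfl | hj
    · have hs := hl.2
      rw [Fin.sum_univ_succAbove _ i, hi] at hs
      simp at hs
    · exact hj
  have hne : ∀ i j, i ≠ j → (Y i).1 = (Y j).1 → ¬ (Y j).2 ≤ (Y i).2 := by
    intro i j hij h1 h2
    refine hred i (Pi.single j 1) (single_mem_stdSimplex ℝ j) (by simp [hij]) ?_ ?_
    · simp [Pi.single_apply, h1]
    · simpa [Pi.single_apply] using h2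
  have hinj : Function.Injective fun i => (Y i).1 := by
    intro i j h
    by_contra hij
    rcases le_total (Y j).2 (Y i).2 with h2 | h2
    · exact hne i j hij h h2
    · exact hne j i (Ne.symm hij) h.symm h2
  calc (m : ℕ∞) = ENat.card (Fin m) := by simp
    _ ≤ (Set.range fun i => (Y i).1).encard := hinj.encard_range
    _ ≤ _ := by
      refine Set.encard_le_encard ?_
      rintro _ ⟨i, rfl⟩
      rw [he]
      exact ⟨(Y i).2, mem_extremePoints_of_not_redundant Y i (hred i)⟩

/-! ### Gaussian mean width of finite families of points -/

/-- The support function `x ↦ max_i (⟨x, xᵢ⟩ - yᵢ)` of the family `X i = (xᵢ, yᵢ)`. -/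
noncomputable def maxAff {n k : ℕ} (X : Fin k → E n × ℝ) (x : E n) : ℝ :=
  ⨆ i, (⟪x, (X i).1⟫_ℝ - (X i).2)

lemma le_maxAff {n k : ℕ} (X : Fin k → E n × ℝ) (x : E n) (i : Fin k) :
    ⟪x, (X i).1⟫_ℝ - (X i).2 ≤ maxAff X x :=
  le_ciSup (f := fun i => ⟪x, (X i).1⟫_ℝ - (X i).2) (Set.finite_range _).bddAbove i

lemma maxAff_le {n k : ℕ} [Nonempty (Fin k)] {X : Fin k → E n × ℝ} {x : E n} {c : ℝ}
    (h : ∀ i, ⟪x, (X i).1⟫_ℝ - (X i).2 ≤ c) : maxAff X x ≤ c := ciSup_le h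

lemma conjugate_innerLin {n k : ℕ} [Nonempty (Fin k)] (X : Fin k → E n × ℝ) (x : E n) :
    conjugate (innerLin X) x = (maxAff X x : EReal) := by
  apply le_antisymm
  · refine iSup_le fun y => ?_
    have h : ((⟪x, y⟫_ℝ - maxAff X x : ℝ) : EReal) ≤ innerLin X y := by
      refine le_iInf fun l => le_iInf fun hl => le_iInf fun hy => EReal.coe_le_coe_iff.2 ?_
      subst hy
      have h1 : ∑ i, l i * (⟪x, (X i).1⟫_ℝ - (X i).2) ≤ ∑ i, l i * maxAff X x :=
        Finset.sum_le_sum fun i _ => mul_le_mul_of_nonneg_left (le_maxAff X x i) (hl.1 i)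
      rw [← Finset.sum_mul, hl.2, one_mul] at h1
      simp only [mul_sub, Finset.sum_sub_distrib] at h1
      rw [inner_sum]
      simp only [inner_smul_right]
      linarith
    refine (EReal.sub_le_sub le_rfl h).trans ?_
    rw [← EReal.coe_sub]
    exact EReal.coe_le_coe_iff.2 (by linarith)
  · obtain ⟨i, hi⟩ := exists_eq_ciSup_of_finite (f := fun i => ⟪x, (X i).1⟫_ℝ - (X i).2)
    rw [maxAff, ← hi, EReal.coe_sub]
    exact le_iSup_of_le (X i).1 (EReal.sub_le_sub le_rfl (single_mem_epi X i))

lemma integrable_maxAff {n k : ℕ} (X : Fin k → E n × ℝ) :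
    Integrable (maxAff X) (stdGaussian (E n)) := by
  rcases isEmpty_or_nonempty (Fin k) with hk | hk
  -- The real supremum over an empty family takes the default value `0`.
  · have : maxAff X = 0 := by funext x; simp [maxAff]
    rw [this]
    exact integrable_zero _ _ _
  have hi : ∀ i, Integrable (fun x => ⟪x, (X i).1⟫_ℝ - (X i).2) (stdGaussian (E n)) := fun i =>
    ((IsGaussian.integrable_id (μ := stdGaussian (E n))).inner_const (X i).1).sub
      (integrable_const _)
  refine Integrable.mono' (integrable_finsetSum Finset.univ fun i _ => (hi i).abs)
    (Measurable.iSup fun i => by fun_prop).aestronglyMeasurable (ae_of_all _ fun x => ?_)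
  obtain ⟨i, hi⟩ := exists_eq_ciSup_of_finite (f := fun i => ⟪x, (X i).1⟫_ℝ - (X i).2)
  rw [maxAff, ← hi, Real.norm_eq_abs]
  exact Finset.single_le_sum (f := fun i => |⟪x, (X i).1⟫_ℝ - (X i).2|)
    (fun j _ => abs_nonneg _) (Finset.mem_univ i)

/-- The Gaussian integral of the support function of a finite family of points. -/
noncomputable def gaussWidth {n k : ℕ} (X : Fin k → E n × ℝ) : ℝ :=
  ∫ x, maxAff X x ∂stdGaussian (E n)

lemma erealIntegral_coe {α : Type*} [MeasurableSpace α] {μ : Measure α} {h : α → ℝ}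
    (hh : Integrable h μ) :
    erealIntegral μ (fun x => (h x : EReal)) = ((∫ x, h x ∂μ : ℝ) : EReal) := by
  have h1 : ∫⁻ x, ENNReal.ofReal (h x) ∂μ ≠ ∞ := hh.lintegral_lt_top.ne
  have h2 : ∫⁻ x, ENNReal.ofReal (-h x) ∂μ ≠ ∞ := hh.neg.lintegral_lt_top.ne
  simp only [erealIntegral, ← EReal.coe_neg, EReal.real_coe_toENNReal]
  rw [integral_eq_lintegral_pos_part_sub_lintegral_neg_part hh, EReal.coe_sub,
    EReal.coe_ennreal_toReal h1, EReal.coe_ennreal_toReal h2]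

lemma meanWidth_innerLin {n k : ℕ} [Nonempty (Fin k)] (X : Fin k → E n × ℝ) :
    meanWidth (fun x => EReal.exp (-innerLin X x)) = ((2 / n * gaussWidth X : ℝ) : EReal) := by
  have hb : base (fun x => EReal.exp (-innerLin X x)) = innerLin X := by
    funext x; simp [base]
  have hs : supportFun (fun x => EReal.exp (-innerLin X x)) = fun x => (maxAff X x : EReal) := by
    funext x; rw [supportFun, hb, conjugate_innerLin]
  rw [meanWidth, hs, erealIntegral_coe (integrable_maxAff X), EReal.coe_mul, gaussWidth]

/-- Break points can be traded for generators: `k` points produce at most `k` break points, and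
conversely `exists_innerLin_card_le` discards all other generators. -/
lemma G_le_iff {n : ℕ} (N : ℕ) (f : E n → ℝ≥0∞) {c : EReal} :
    G N f ≤ c ↔ ∀ (k : ℕ) (X : Fin k → E n × ℝ), 0 < k → k ≤ N → (∀ i, X i ∈ epi (base f)) →
      ((2 / n * gaussWidth X : ℝ) : EReal) ≤ c := by
  constructor
  · intro h k X hk hkN hX
    have : Nonempty (Fin k) := ⟨⟨0, hk⟩⟩
    rw [← meanWidth_innerLin]
    refine le_trans ?_ h
    refine le_iSup₂_of_le _ ⟨innerLin X, ⟨⟨k, X, hk, hX, rfl⟩, ?_⟩, rfl⟩ le_rfl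
    calc (breakPoints (innerLin X)).encard ≤ (Set.range fun i => (X i).1).encard :=
          Set.encard_le_encard (breakPoints_innerLin_subset X)
      _ ≤ (Set.univ : Set (Fin k)).encard := by
          rw [← Set.image_univ]; exact Set.encard_image_le _ _
      _ ≤ N := by simpa using hkN
  · intro h
    refine iSup₂_le ?_
    rintro _ ⟨_, ⟨⟨k, X, hk, hX, rfl⟩, hN⟩, rfl⟩
    obtain ⟨m, Y, hm, hY, he, hle⟩ := exists_innerLin_card_le hk X hX
    have : Nonempty (Fin m) := ⟨⟨0, hm⟩⟩
    rw [he, meanWidth_innerLin]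
    exact h m Y hm (by exact_mod_cast hle.trans hN) hY

/-- A maximum of averages is at most the average of the maxima; moving `refl u` onto the variable
leaves the Gaussian integral unchanged. -/
lemma gaussWidth_symm_le {n k : ℕ} [Nonempty (Fin k)] (u : E n) {X A B : Fin k → E n × ℝ}
    (h : ∀ i, X i = ((1 / 2 : ℝ) • ((A i).1 + refl u (B i).1), ((A i).2 + (B i).2) / 2)) :
    gaussWidth X ≤ (gaussWidth A + gaussWidth B) / 2 := by
  have hmp : MeasurePreserving (refl u).toMeasurableEquiv (stdGaussian (E n))
      (stdGaussian (E n)) := ⟨(refl u).toMeasurableEquiv.measurable, stdGaussian_map (refl u)⟩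
  have hB : ∫ x, maxAff B (refl u x) ∂stdGaussian (E n) = gaussWidth B :=
    hmp.integral_comp' (maxAff B)
  have hBi : Integrable (fun x => maxAff B (refl u x)) (stdGaussian (E n)) :=
    hmp.integrable_comp_of_integrable (integrable_maxAff B)
  calc gaussWidth X ≤ ∫ x, (maxAff A x + maxAff B (refl u x)) / 2 ∂stdGaussian (E n) := by
        refine integral_mono (integrable_maxAff X)
          (((integrable_maxAff A).add hBi).div_const 2) fun x => maxAff_le fun i => ?_
        have h1 := le_maxAff A x i
        have h2 := le_maxAff B (refl u x) i
        rw [inner_refl_left] at h2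
        rw [h i]
        simp only [inner_smul_right, inner_add_right]
        linarith
    _ = _ := by
        rw [integral_div, integral_add (integrable_maxAff A) hBi, hB]
        rfl

lemma gaussWidth_epiSeq_le {n k : ℕ} [Nonempty (Fin k)] (u : ℕ → E n) (f : E n → ℝ≥0∞) {c : ℝ}
    (h : ∀ X : Fin k → E n × ℝ, (∀ i, X i ∈ epi (base f)) → gaussWidth X ≤ c) (m : ℕ) :
    ∀ X : Fin k → E n × ℝ, (∀ i, X i ∈ epiSeq u f m) → gaussWidth X ≤ c := by
  induction m with
  | zero => exact h
  | succ m ih =>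
    intro X hX
    choose A hA B hB hAB using hX
    have := gaussWidth_symm_le (u m) hAB
    linarith [ih A hA, ih B hB]

lemma gaussWidth_le_add {n k : ℕ} [Nonempty (Fin k)] {X Y : Fin k → E n × ℝ} {δ : ℝ}
    (h1 : ∀ i, ‖(X i).1 - (Y i).1‖ ≤ δ) (h2 : ∀ i, (Y i).2 ≤ (X i).2 + δ) :
    gaussWidth X ≤ gaussWidth Y + δ * (∫ x, ‖x‖ ∂stdGaussian (E n) + 1) := by
  have hn : Integrable (fun x : E n => ‖x‖) (stdGaussian (E n)) :=
    (IsGaussian.integrable_id (μ := stdGaussian (E n))).norm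
  have hn' : Integrable (fun x : E n => δ * (‖x‖ + 1)) (stdGaussian (E n)) :=
    (hn.add (integrable_const 1)).const_mul δ
  calc gaussWidth X ≤ ∫ x, (maxAff Y x + δ * (‖x‖ + 1)) ∂stdGaussian (E n) := by
        refine integral_mono (integrable_maxAff X)
          ((integrable_maxAff Y).add hn') fun x => maxAff_le fun i => ?_
        have h3 := le_maxAff Y x i
        have h4 : ⟪x, (X i).1 - (Y i).1⟫_ℝ ≤ ‖x‖ * δ :=
          (real_inner_le_norm _ _).trans (mul_le_mul_of_nonneg_left (h1 i) (norm_nonneg _))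
        rw [inner_sub_right] at h4
        linarith [h2 i]
    _ = _ := by
        rw [integral_add (integrable_maxAff Y) hn', integral_const_mul,
          integral_add hn (integrable_const 1)]
        simp [gaussWidth]

/-- `G_N` does not increase when passing to hypo-limits of successive Minkowski symmetrals. -/
theorem G_le_of_hypoConverges {n : ℕ} (hn : 1 ≤ n) (N : ℕ) {f g : E n → ℝ≥0∞} {u : ℕ → E n}
    (h : HypoConverges (iterSym u f) g) : G N g ≤ G N f := by
  rw [G_le_iff]
  intro k X hk hkN hX
  have : Nonempty (Fin k) := ⟨⟨0, hk⟩⟩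
  have hn0 : (0 : ℝ) < n := by exact_mod_cast hn
  refine EReal.le_of_forall_lt_iff_le.1 fun c hc => EReal.coe_le_coe_iff.2 ?_
  have hf : ∀ Y : Fin k → E n × ℝ, (∀ i, Y i ∈ epi (base f)) → gaussWidth Y ≤ c * n / 2 := by
    intro Y hY
    have := EReal.coe_le_coe_iff.1 ((G_le_iff N f).1 hc.le k Y hk hkN hY)
    rw [div_mul_eq_mul_div, div_le_iff₀ hn0] at this
    linarith
  suffices hs : gaussWidth X ≤ c * n / 2 by
    rw [div_mul_eq_mul_div, div_le_iff₀ hn0]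
    linarith
  have hC : 0 < ∫ x, ‖x‖ ∂stdGaussian (E n) + 1 :=
    add_pos_of_nonneg_of_pos (integral_nonneg fun x => norm_nonneg x) one_pos
  refine le_of_forall_pos_le_add fun ε hε => ?_
  set δ := ε / (∫ x, ‖x‖ ∂stdGaussian (E n) + 1) with hδ
  have hδ0 : 0 < δ := div_pos hε hC
  choose s hs1 hs2 using fun i => (h (X i).1).2
  -- Raising the heights by `δ` makes the inequality strict, as membership in `epiSeq` requires.
  have hev : ∀ᶠ j in atTop, ∀ i, ‖s i j - (X i).1‖ < δ ∧
      base (iterSym u f j) (s i j) < (((X i).2 + δ : ℝ) : EReal) := by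
    refine eventually_all.2 fun i => ?_
    have h1 := (tendsto_iff_norm_sub_tendsto_zero.1 (hs1 i)).eventually_lt_const hδ0
    have h2 := (hs2 i).eventually_lt_const (u := (((X i).2 + δ : ℝ) : EReal))
      (lt_of_le_of_lt (hX i) (EReal.coe_lt_coe_iff.2 (by linarith)))
    exact h1.and h2
  obtain ⟨j, hj⟩ := hev.exists
  have hle := gaussWidth_le_add (X := X) (Y := fun i => (s i j, (X i).2 + δ)) (δ := δ)
    (fun i => by rw [norm_sub_rev]; exact (hj i).1.le) (fun i => le_rfl)
  have := gaussWidth_epiSeq_le u f hf j (fun i => (s i j, (X i).2 + δ))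
    (fun i => mem_epiSeq_of_lt u f j _ _ (hj i).2)
  rw [hδ, div_mul_cancel₀ _ hC.ne'] at hle
  linarith

/-! ### Averaging along reflections -/

lemma refl_apply_of_norm_eq_one {n : ℕ} {v : E n} (hv : ‖v‖ = 1) (x : E n) :
    refl v x = x - (2 * ⟪v, x⟫_ℝ) • v := by
  rw [refl, Submodule.reflection_orthogonal_apply, Submodule.reflection_singleton_apply]
  simp only [hv, one_pow, div_one, RCLike.ofReal_one]
  module

/-- The reflection along `x - y` sends `x` exactly to `y`, and `refl v x` is `4‖x‖`-Lipschitz in the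
unit vector `v`. -/
lemma norm_refl_sub_le {n : ℕ} {x y v : E n} (hxy : ‖x‖ = ‖y‖) (hne : x ≠ y) (hv : ‖v‖ = 1)
    {δ : ℝ} (h : ‖v - ‖x - y‖⁻¹ • (x - y)‖ ≤ δ) : ‖refl v x - y‖ ≤ 4 * δ * ‖x‖ := by
  have hd : ‖x - y‖ ≠ 0 := norm_ne_zero_iff.2 (sub_ne_zero.2 hne)
  obtain ⟨w, hw⟩ : ∃ w, w = ‖x - y‖⁻¹ • (x - y) := ⟨_, rfl⟩
  rw [← hw] at h
  have hw1 : ‖w‖ = 1 := by rw [hw, norm_smul, norm_inv, norm_norm, inv_mul_cancel₀ hd]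
  have hy : refl w x = y := by
    have hsp : Submodule.span ℝ {w} = Submodule.span ℝ {x - y} := by
      rw [hw, Submodule.span_singleton_smul_eq (IsUnit.mk0 _ (inv_ne_zero hd))]
    simp only [refl, hsp]
    exact Submodule.reflection_sub hxy
  have e : refl v x - y = (2 * ⟪w - v, x⟫_ℝ) • w + (2 * ⟪v, x⟫_ℝ) • (w - v) := by
    conv_lhs => rw [← hy, refl_apply_of_norm_eq_one hv, refl_apply_of_norm_eq_one hw1]
    rw [inner_sub_left]
    module
  have h' : ‖w - v‖ ≤ δ := by rwa [norm_sub_rev]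
  have b1 : |⟪w - v, x⟫_ℝ| ≤ δ * ‖x‖ :=
    (abs_real_inner_le_norm _ _).trans (mul_le_mul_of_nonneg_right h' (norm_nonneg _))
  have b2 : |⟪v, x⟫_ℝ| ≤ ‖x‖ := by simpa [hv] using abs_real_inner_le_norm v x
  rw [e]
  refine (norm_add_le _ _).trans ?_
  rw [norm_smul, norm_smul, hw1, norm_mul, norm_mul, Real.norm_eq_abs, Real.norm_eq_abs,
    Real.norm_eq_abs, abs_two]
  have b3 : |⟪v, x⟫_ℝ| * ‖w - v‖ ≤ ‖x‖ * δ :=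
    mul_le_mul b2 h' (norm_nonneg _) (norm_nonneg _)
  linarith

/-! ### Rich sequences of directions -/

/-- A sequence of unit vectors which contains, arbitrarily late, finite blocks of bounded length
that are dense in the sphere up to any given precision. -/
structure IsRichSeq {n : ℕ} (u : ℕ → E n) : Prop where
  norm_eq_one : ∀ i, ‖u i‖ = 1
  dense : ∀ δ > 0, ∃ L : ℕ, ∀ m₀, ∃ m ≥ m₀, ∀ w : E n, ‖w‖ = 1 → ∃ i < L, ‖u (m + i) - w‖ ≤ δ

lemma exists_isRichSeq {n : ℕ} (hn : 1 ≤ n) : ∃ u : ℕ → E n, IsRichSeq u := by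
  have : Nonempty (Fin n) := ⟨⟨0, hn⟩⟩
  have : Nonempty (Metric.sphere (0 : E n) 1) :=
    (NormedSpace.sphere_nonempty.2 zero_le_one).to_subtype
  let v := TopologicalSpace.denseSeq (Metric.sphere (0 : E n) 1)
  have hvd : DenseRange v := TopologicalSpace.denseRange_denseSeq _
  -- The dense sequence `v` is restarted at each power of two, so ever longer initial segments of it
  -- recur.
  refine ⟨fun m => v (m - 2 ^ Nat.log 2 m), fun i => by simp, fun δ hδ => ?_⟩
  obtain ⟨t, ht⟩ := isCompact_univ.elim_finite_subcover (fun i => Metric.ball (v i) δ)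
    (fun i => Metric.isOpen_ball) (fun w _ => by
      obtain ⟨i, hi⟩ := hvd.exists_dist_lt w hδ
      exact Set.mem_iUnion.2 ⟨i, hi⟩)
  obtain ⟨L, hL⟩ := t.bddAbove
  refine ⟨L + 1, fun m₀ => ⟨2 ^ (m₀ + (L + 1)), ?_, fun w hw => ?_⟩⟩
  · exact (Nat.le_add_right _ _).trans Nat.lt_two_pow_self.le
  · have hmem := ht (Set.mem_univ (⟨w, by simpa using hw⟩ : Metric.sphere (0 : E n) 1))
    simp only [Set.mem_iUnion, Metric.mem_ball] at hmem
    obtain ⟨i, hit, hi⟩ := hmem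
    have hiL : i ≤ L := hL hit
    have hlt : i < 2 ^ (m₀ + (L + 1)) :=
      lt_of_le_of_lt (by omega) (Nat.lt_two_pow_self (n := m₀ + (L + 1)))
    have hlog : Nat.log 2 (2 ^ (m₀ + (L + 1)) + i) = m₀ + (L + 1) :=
      Nat.log_eq_of_pow_le_of_lt_pow (by omega) (by rw [pow_succ]; omega)
    refine ⟨i, by omega, ?_⟩
    rw [hlog, Nat.add_sub_cancel_left, ← dist_eq_norm, dist_comm]
    exact hi.le

lemma IsRichSeq.exists_near {n : ℕ} {u : ℕ → E n} (hu : IsRichSeq u) {ρ η : ℝ} (hη : 0 < η)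
    (hρ : 0 ≤ ρ) : ∃ L : ℕ, ∀ m₀, ∃ m ≥ m₀, ∀ x y : E n, ‖x‖ = ‖y‖ → ‖x‖ ≤ ρ → x ≠ y →
      ∃ i < L, ‖refl (u (m + i)) x - y‖ ≤ η := by
  -- The factor `4 * ‖x‖` of `norm_refl_sub_le` is absorbed; `ρ + 1` avoids dividing by zero.
  obtain ⟨L, hL⟩ := hu.dense (η / (4 * (ρ + 1))) (by positivity)
  refine ⟨L, fun m₀ => ?_⟩
  obtain ⟨m, hm, h⟩ := hL m₀
  refine ⟨m, hm, fun x y hxy hx hne => ?_⟩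
  have hd : ‖x - y‖ ≠ 0 := norm_ne_zero_iff.2 (sub_ne_zero.2 hne)
  obtain ⟨i, hi, hi2⟩ := h (‖x - y‖⁻¹ • (x - y))
    (by rw [norm_smul, norm_inv, norm_norm, inv_mul_cancel₀ hd])
  refine ⟨i, hi, (norm_refl_sub_le hxy hne (hu.norm_eq_one _) hi2).trans ?_⟩
  have : 4 * (η / (4 * (ρ + 1))) * ‖x‖ ≤ 4 * (η / (4 * (ρ + 1))) * (ρ + 1) := by
    gcongr; linarith
  refine this.trans (le_of_eq ?_)
  field_simp

/-- Successive averages of a function over reflections. -/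
noncomputable def avgSeq {n : ℕ} (u : ℕ → E n) (a : E n → ℝ) : ℕ → E n → ℝ
  | 0 => a
  | m + 1 => fun y => (avgSeq u a m y + avgSeq u a m (refl (u m) y)) / 2

section avgSeq

variable {n : ℕ} {u : ℕ → E n} {a : E n → ℝ}

lemma avgSeq_le {r C : ℝ} {k m : ℕ} (hkm : k ≤ m)
    (h : ∀ y, ‖y‖ = r → avgSeq u a k y ≤ C) : ∀ y, ‖y‖ = r → avgSeq u a m y ≤ C := by
  induction m, hkm using Nat.le_induction with
  | base => exact h
  | succ m _ ih =>
    intro y hy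
    have h1 := ih y hy
    have h2 := ih (refl (u m) y) (by rwa [LinearIsometryEquiv.norm_map])
    simp only [avgSeq]
    linarith

lemma le_avgSeq {r C : ℝ} {k m : ℕ} (hkm : k ≤ m)
    (h : ∀ y, ‖y‖ = r → C ≤ avgSeq u a k y) : ∀ y, ‖y‖ = r → C ≤ avgSeq u a m y := by
  induction m, hkm using Nat.le_induction with
  | base => exact h
  | succ m _ ih =>
    intro y hy
    have h1 := ih y hy
    have h2 := ih (refl (u m) y) (by rwa [LinearIsometryEquiv.norm_map])
    simp only [avgSeq]
    linarith

lemma avgSeq_zero_apply (m : ℕ) : avgSeq u a m 0 = a 0 := by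
  induction m with
  | zero => rfl
  | succ m ih => simp [avgSeq, ih]

/-- Reflections are isometries fixing the origin, so the modulus of continuity of `a` on the ball
serves all averages at once. -/
lemma avgSeq_modulus {ρ δ e : ℝ}
    (h : ∀ x y, ‖x‖ ≤ ρ → ‖y‖ ≤ ρ → ‖x - y‖ ≤ δ → a x - a y ≤ e) (m : ℕ) :
    ∀ x y, ‖x‖ ≤ ρ → ‖y‖ ≤ ρ → ‖x - y‖ ≤ δ → avgSeq u a m x - avgSeq u a m y ≤ e := by
  induction m with
  | zero => exact h
  | succ m ih =>
    intro x y hx hy hxy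
    have h1 := ih x y hx hy hxy
    have h2 := ih (refl (u m) x) (refl (u m) y) (by rwa [LinearIsometryEquiv.norm_map])
      (by rwa [LinearIsometryEquiv.norm_map])
      (by rwa [← map_sub, LinearIsometryEquiv.norm_map])
    simp only [avgSeq]
    linarith

lemma avgSeq_add_le {r M : ℝ} {m : ℕ} (h : ∀ y, ‖y‖ = r → avgSeq u a m y ≤ M) (L : ℕ) {x : E n}
    (hx : ‖x‖ = r) :
    avgSeq u a (m + L) x ≤ (1 - (1 / 2) ^ L) * M + (1 / 2) ^ L * avgSeq u a m x := by
  induction L with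
  | zero => simp
  | succ L ih =>
    have h2 := avgSeq_le (Nat.le_add_right m L) h (refl (u (m + L)) x)
      (by rwa [LinearIsometryEquiv.norm_map])
    rw [← add_assoc]
    simp only [avgSeq, pow_succ]
    linarith

/-- Expanding the `L` averages, the term that reflects only at step `m + i` has weight `2⁻ᴸ`; all
others are bounded by `M`. -/
lemma avgSeq_add_le_refl {r M : ℝ} {m : ℕ} (h : ∀ y, ‖y‖ = r → avgSeq u a m y ≤ M) {L i : ℕ}
    (hi : i < L) {x : E n} (hx : ‖x‖ = r) :
    avgSeq u a (m + L) x ≤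
      (1 - (1 / 2) ^ L) * M + (1 / 2) ^ L * avgSeq u a m (refl (u (m + i)) x) := by
  obtain ⟨j, rfl⟩ : ∃ j, L = i + 1 + j := ⟨L - (i + 1), by omega⟩
  have hx' : ‖refl (u (m + i)) x‖ = r := by rwa [LinearIsometryEquiv.norm_map]
  have h1 := avgSeq_add_le (avgSeq_le (Nat.le_add_right m (i + 1)) h) j hx
  have h2 : avgSeq u a (m + (i + 1)) x ≤ (M + avgSeq u a (m + i) (refl (u (m + i)) x)) / 2 := by
    have := avgSeq_le (Nat.le_add_right m i) h x hx
    rw [← add_assoc]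
    simp only [avgSeq]
    linarith
  have h3 := avgSeq_add_le h i hx'
  rw [← add_assoc]
  have hj : (0 : ℝ) ≤ (1 / 2) ^ j := by positivity
  calc avgSeq u a (m + (i + 1) + j) x
      ≤ (1 - (1 / 2) ^ j) * M + (1 / 2) ^ j * avgSeq u a (m + (i + 1)) x := h1
    _ ≤ (1 - (1 / 2) ^ j) * M + (1 / 2) ^ j * ((M + ((1 - (1 / 2) ^ i) * M +
          (1 / 2) ^ i * avgSeq u a m (refl (u (m + i)) x))) / 2) := by
        gcongr
        linarith
    _ = _ := by rw [pow_add, pow_succ]; ring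

/-- The oscillation of `avgSeq u a m` on each sphere of radius at most `ρ` is at most `C`. -/
def OscLe (u : ℕ → E n) (a : E n → ℝ) (ρ : ℝ) (m : ℕ) (C : ℝ) : Prop :=
  ∀ x y, ‖x‖ = ‖y‖ → ‖x‖ ≤ ρ → avgSeq u a m x - avgSeq u a m y ≤ C

lemma OscLe.mono {ρ C : ℝ} {k m : ℕ} (h : OscLe u a ρ k C) (hkm : k ≤ m) : OscLe u a ρ m C := by
  intro x y hxy hx
  have h1 : ∀ z, ‖z‖ = ‖x‖ → avgSeq u a m x - C ≤ avgSeq u a k z := fun z hz => by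
    have := avgSeq_le (u := u) (a := a) (r := ‖x‖) (C := avgSeq u a k z + C) hkm
      (fun w hw => by linarith [h w z (hw.trans hz.symm) (hw.trans_le hx)]) x rfl
    linarith
  have := le_avgSeq hkm h1 y hxy.symm
  linarith

/-- For any `x`, `z` on a common sphere, some direction in the block reflects `x` to within `δ` of
`z`. Hence the later value at `x` contains the value near `z` with weight `q = 2⁻ᴸ`. As `L` depends
only on `ρ` and `δ`, the contraction can be iterated. -/
lemma OscLe.contract (hu : IsRichSeq u) {ρ δ e : ℝ} (hρ : 0 ≤ ρ) (hδ : 0 < δ)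
    (h : ∀ x y, ‖x‖ ≤ ρ → ‖y‖ ≤ ρ → ‖x - y‖ ≤ δ → a x - a y ≤ e) :
    ∃ q : ℝ, 0 < q ∧ q ≤ 1 ∧ ∀ k C, OscLe u a ρ k C →
      ∃ m, OscLe u a ρ m ((1 - q) * C + q * e) := by
  obtain ⟨L, hL⟩ := hu.exists_near hδ hρ
  refine ⟨(1 / 2) ^ L, by positivity, pow_le_one₀ (by norm_num) (by norm_num), fun k C hC => ?_⟩
  obtain ⟨m, hm, hnear⟩ := hL k
  have hCm := hC.mono hm
  refine ⟨m + L, fun x y hxy hx => ?_⟩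
  have he : 0 ≤ e := by simpa using h 0 0 (by simpa) (by simpa) (by simpa using hδ.le)
  have hq : (0 : ℝ) ≤ (1 / 2) ^ L := by positivity
  have h1 : ∀ z, ‖z‖ = ‖x‖ →
      avgSeq u a (m + L) x - ((1 - (1 / 2) ^ L) * C + (1 / 2) ^ L * e) ≤ avgSeq u a m z := by
    intro z hz
    have hM : ∀ w, ‖w‖ = ‖x‖ → avgSeq u a m w ≤ avgSeq u a m z + C := fun w hw => by
      linarith [hCm w z (hw.trans hz.symm) (hw.trans_le hx)]
    by_cases hxz : x = z
    · subst hxz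
      have := avgSeq_add_le hM L rfl
      have := mul_nonneg hq he
      linarith
    · obtain ⟨i, hi, hn⟩ := hnear x z hz.symm hx hxz
      have h2 := avgSeq_add_le_refl hM hi rfl
      have h3 := mul_le_mul_of_nonneg_left (avgSeq_modulus (u := u) h m (refl (u (m + i)) x) z
        (by rwa [LinearIsometryEquiv.norm_map]) (hz.trans_le hx) hn) hq
      linarith
  have := le_avgSeq (Nat.le_add_right m L) h1 y hxy.symm
  linarith

/-- Along a rich sequence of directions, the averages become asymptotically constant on spheres,
uniformly on balls on which the function is continuous. -/
lemma eventually_oscLe (hu : IsRichSeq u) {ρ : ℝ} (hρ : 0 ≤ ρ)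
    (ha : ContinuousOn a (Metric.closedBall 0 ρ)) {ε : ℝ} (hε : 0 < ε) :
    ∀ᶠ m in atTop, OscLe u a ρ m ε := by
  have hcpt : IsCompact (Metric.closedBall (0 : E n) ρ) := isCompact_closedBall _ _
  have huc := Metric.uniformContinuousOn_iff_le.1 (hcpt.uniformContinuousOn_of_continuous ha)
  obtain ⟨δ, hδ, hmod⟩ := huc (ε / 2) (by positivity)
  obtain ⟨q, hq0, hq1, hstep⟩ := OscLe.contract (u := u) (a := a) (e := ε / 2) hu hρ hδ
    (fun x y hx hy hxy => (le_abs_self _).trans (hmod x (by simpa using hx) y (by simpa using hy)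
      (by rwa [dist_eq_norm])))
  obtain ⟨B, hB⟩ := (hcpt.image_of_continuousOn ha).isBounded.exists_norm_le
  have hB' : ∀ x : E n, ‖x‖ ≤ ρ → |a x| ≤ B := fun x hx => hB _ ⟨x, by simpa using hx, rfl⟩
  -- The fixed point of `C ↦ (1 - q) * C + q * (ε / 2)` is `ε / 2`; the excess over it decays
  -- geometrically.
  have hit : ∀ j : ℕ, ∃ m, OscLe u a ρ m (ε / 2 + (1 - q) ^ j * (2 * B)) := by
    intro j
    induction j with
    | zero =>
      refine ⟨0, fun x y hxy hx => ?_⟩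
      have h1 := abs_le.1 (hB' x hx)
      have h2 := abs_le.1 (hB' y (hxy ▸ hx))
      simp only [avgSeq, pow_zero]
      linarith
    | succ j ih =>
      obtain ⟨k, hk⟩ := ih
      obtain ⟨m, hm⟩ := hstep k _ hk
      refine ⟨m, ?_⟩
      convert hm using 1
      rw [pow_succ]; ring
  have hlim : Tendsto (fun j : ℕ => (1 - q) ^ j * (2 * B)) atTop (𝓝 0) := by
    simpa using (tendsto_pow_atTop_nhds_zero_of_lt_one (by linarith : 0 ≤ 1 - q)
      (by linarith)).mul_const (2 * B)
  obtain ⟨j, hj⟩ := (hlim.eventually_lt_const (half_pos hε)).exists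
  obtain ⟨k, hk⟩ := hit j
  filter_upwards [eventually_ge_atTop k] with m hm x y hxy hx
  linarith [hk.mono hm x y hxy hx]

/-- Later averages stay within the range of `avgSeq u a k` on the sphere, so small oscillation
yields the Cauchy property. -/
lemma OscLe.sub_le {ρ C : ℝ} {k m : ℕ} (h : OscLe u a ρ k C) (hkm : k ≤ m) {x : E n}
    (hx : ‖x‖ ≤ ρ) : |avgSeq u a m x - avgSeq u a k x| ≤ C := by
  have h1 := avgSeq_le (u := u) (a := a) (r := ‖x‖) (C := avgSeq u a k x + C) hkm
    (fun w hw => by linarith [h w x hw (hw.trans_le hx)]) x rfl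
  have h2 := le_avgSeq (u := u) (a := a) (r := ‖x‖) (C := avgSeq u a k x - C) hkm
    (fun w hw => by linarith [h x w hw.symm hx]) x rfl
  exact abs_le.2 ⟨by linarith, by linarith⟩

lemma exists_tendsto_avgSeq (hu : IsRichSeq u) {x : E n}
    (ha : ContinuousOn a (Metric.closedBall 0 ‖x‖)) :
    ∃ b, Tendsto (fun m => avgSeq u a m x) atTop (𝓝 b) := by
  refine cauchySeq_tendsto_of_complete (Metric.cauchySeq_iff'.2 fun ε hε => ?_)
  obtain ⟨k, hk⟩ := (eventually_oscLe hu (norm_nonneg x) ha (half_pos hε)).exists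
  refine ⟨k, fun m hm => ?_⟩
  rw [Real.dist_eq]
  exact (hk.sub_le hm le_rfl).trans_lt (half_lt_self hε)

end avgSeq

/-! ### Support functions of subsets of `ℝⁿ × ℝ` -/

/-- The affine functional `(z, t) ↦ ⟨z, y⟩ - t`. -/
noncomputable def aff {n : ℕ} (y : E n) (p : E n × ℝ) : ℝ := ⟪p.1, y⟫_ℝ - p.2

/-- The set of all `y` for which `(z, t) ↦ ⟨z, y⟩ - t` is bounded above on `K`. -/
def suppDom {n : ℕ} (K : Set (E n × ℝ)) : Set (E n) := {y | BddAbove (aff y '' K)}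

/-- The support function `y ↦ sup_{(z, t) ∈ K} (⟨z, y⟩ - t)`. -/
noncomputable def supp {n : ℕ} (K : Set (E n × ℝ)) (y : E n) : ℝ := sSup (aff y '' K)

lemma mem_suppDom_iff {n : ℕ} {K : Set (E n × ℝ)} {y : E n} :
    y ∈ suppDom K ↔ ∃ c, ∀ p ∈ K, aff y p ≤ c := by
  simp only [suppDom, Set.mem_ofPred_eq, BddAbove, Set.Nonempty, mem_upperBounds,
    Set.forall_mem_image]

lemma aff_combo {n : ℕ} (x y : E n) (p : E n × ℝ) {s t : ℝ} (hst : s + t = 1) :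
    aff (s • x + t • y) p = s * aff x p + t * aff y p := by
  simp only [aff, inner_add_right, inner_smul_right]
  linear_combination p.2 * hst

lemma convex_suppDom {n : ℕ} (K : Set (E n × ℝ)) : Convex ℝ (suppDom K) := by
  intro x hx y hy s t hs ht hst
  rw [mem_suppDom_iff] at hx hy ⊢
  obtain ⟨c, hc⟩ := hx
  obtain ⟨d, hd⟩ := hy
  refine ⟨s * c + t * d, fun p hp => ?_⟩
  rw [aff_combo x y p hst]
  exact add_le_add (mul_le_mul_of_nonneg_left (hc p hp) hs)
    (mul_le_mul_of_nonneg_left (hd p hp) ht)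

lemma isLUB_supp {n : ℕ} {K : Set (E n × ℝ)} (hK : K.Nonempty) {y : E n} (hy : y ∈ suppDom K) :
    IsLUB (aff y '' K) (supp K y) := isLUB_csSup (hK.image _) hy

lemma convexOn_supp {n : ℕ} {K : Set (E n × ℝ)} (hK : K.Nonempty) :
    ConvexOn ℝ (suppDom K) (supp K) := by
  refine ⟨convex_suppDom K, fun x hx y hy s t hs ht hst => csSup_le (hK.image _) ?_⟩
  rintro _ ⟨p, hp, rfl⟩
  rw [aff_combo x y p hst]
  exact add_le_add (mul_le_mul_of_nonneg_left ((isLUB_supp hK hx).1 ⟨p, hp, rfl⟩) hs)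
    (mul_le_mul_of_nonneg_left ((isLUB_supp hK hy).1 ⟨p, hp, rfl⟩) ht)

lemma aff_symm {n : ℕ} (u y : E n) (a b : E n × ℝ) :
    aff y ((1 / 2 : ℝ) • (a.1 + refl u b.1), (a.2 + b.2) / 2) =
      (aff y a + aff (refl u y) b) / 2 := by
  simp only [aff, inner_smul_left, inner_add_left, inner_refl_left]
  simp
  ring

lemma symSet_nonempty {n : ℕ} (u : E n) {K : Set (E n × ℝ)} (hK : K.Nonempty) :
    (symSet u K).Nonempty := by
  obtain ⟨p, hp⟩ := hK
  exact ⟨_, p, hp, p, hp, rfl⟩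

/-- The two points of `K` vary independently, so the supremum of the sum splits. -/
lemma isLUB_symSet {n : ℕ} {u y : E n} {K : Set (E n × ℝ)} {a b : ℝ}
    (ha : IsLUB (aff y '' K) a) (hb : IsLUB (aff (refl u y) '' K) b) :
    IsLUB (aff y '' symSet u K) ((a + b) / 2) := by
  constructor
  · rintro _ ⟨_, ⟨p, hp, q, hq, rfl⟩, rfl⟩
    rw [aff_symm]
    linarith [ha.1 ⟨p, hp, rfl⟩, hb.1 ⟨q, hq, rfl⟩]
  · intro c hc
    have h1 : ∀ q ∈ K, a ≤ 2 * c - aff (refl u y) q := by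
      intro q hq
      refine ha.2 ?_
      rintro _ ⟨p, hp, rfl⟩
      have := hc ⟨_, ⟨p, hp, q, hq, rfl⟩, rfl⟩
      rw [aff_symm] at this
      linarith
    have h2 : b ≤ 2 * c - a := by
      refine hb.2 ?_
      rintro _ ⟨q, hq, rfl⟩
      linarith [h1 q hq]
    linarith

lemma mem_suppDom_symSet {n : ℕ} {u y : E n} {K : Set (E n × ℝ)} (hK : K.Nonempty) :
    y ∈ suppDom (symSet u K) ↔ y ∈ suppDom K ∧ refl u y ∈ suppDom K := by
  constructor
  · rw [mem_suppDom_iff, mem_suppDom_iff, mem_suppDom_iff]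
    rintro ⟨c, hc⟩
    obtain ⟨r, hr⟩ := hK
    constructor
    · refine ⟨2 * c - aff (refl u y) r, fun p hp => ?_⟩
      have := hc _ ⟨p, hp, r, hr, rfl⟩
      rw [aff_symm] at this
      linarith
    · refine ⟨2 * c - aff y r, fun p hp => ?_⟩
      have := hc _ ⟨r, hr, p, hp, rfl⟩
      rw [aff_symm] at this
      linarith
  · rintro ⟨h1, h2⟩
    exact (isLUB_symSet (isLUB_supp hK h1) (isLUB_supp hK h2)).bddAbove

/-! ### Support functions of the iterated epigraphs and their domains -/

section epiSeq

variable {n : ℕ} {u : ℕ → E n} {f : E n → ℝ≥0∞}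

lemma epiSeq_nonempty (hf : (epi (base f)).Nonempty) (m : ℕ) : (epiSeq u f m).Nonempty := by
  induction m with
  | zero => exact hf
  | succ m ih => exact symSet_nonempty _ ih

lemma convex_epiSeq (hf : Convex ℝ (epi (base f))) (m : ℕ) : Convex ℝ (epiSeq u f m) := by
  induction m with
  | zero => exact hf
  | succ m ih => exact convex_symSet _ ih

lemma isLUB_avgSeq (hf : (epi (base f)).Nonempty) {r : ℝ}
    (hr : Metric.ball 0 r ⊆ suppDom (epi (base f))) (m : ℕ) :
    ∀ y : E n, ‖y‖ < r → IsLUB (aff y '' epiSeq u f m) (avgSeq u (supp (epi (base f))) m y) := by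
  induction m with
  | zero => exact fun y hy => isLUB_supp hf (hr (by simpa using hy))
  | succ m ih =>
    exact fun y hy => isLUB_symSet (ih y hy) (ih _ (by rwa [LinearIsometryEquiv.norm_map]))

lemma suppDom_epiSeq_anti (hf : (epi (base f)).Nonempty) {k m : ℕ} (hkm : k ≤ m) :
    suppDom (epiSeq u f m) ⊆ suppDom (epiSeq u f k) := by
  induction m, hkm using Nat.le_induction with
  | base => exact subset_rfl
  | succ m _ ih => exact fun y hy => ih ((mem_suppDom_symSet (epiSeq_nonempty hf m)).1 hy).1

lemma refl_mem_suppDom (hf : (epi (base f)).Nonempty) {m : ℕ} {y : E n}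
    (hy : y ∈ suppDom (epiSeq u f (m + 1))) : refl (u m) y ∈ suppDom (epi (base f)) :=
  suppDom_epiSeq_anti hf (Nat.zero_le m) ((mem_suppDom_symSet (epiSeq_nonempty hf m)).1 hy).2

/-- The domains of the support functions eventually lie in every ball which is strictly larger
than the largest centred ball in the initial domain. -/
lemma eventually_suppDom_subset (hu : IsRichSeq u) (hf : (epi (base f)).Nonempty) {ρ₀ ρ : ℝ}
    (hρ₀ : 0 < ρ₀) (h₀ : Metric.ball 0 ρ₀ ⊆ suppDom (epi (base f)))
    (hρ : ¬ Metric.ball 0 ρ ⊆ suppDom (epi (base f))) :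
    ∀ᶠ m in atTop, ∀ y ∈ suppDom (epiSeq u f m), ‖y‖ ≤ ρ := by
  obtain ⟨z, hzρ, hz⟩ := Set.not_subset.1 hρ
  rw [mem_ball_zero_iff] at hzρ
  have hz0 : 0 < ‖z‖ := by
    refine norm_pos_iff.2 fun h => hz ?_
    rw [h]
    exact h₀ (by simpa using hρ₀)
  have hρ0 : 0 < ρ := hz0.trans hzρ
  set t := ‖z‖ / ρ with ht
  have ht0 : 0 < t := div_pos hz0 hρ0
  have ht1 : t < 1 := (div_lt_one hρ0).2 hzρ
  set w := t⁻¹ • z with hw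
  have hwn : ‖w‖ = ρ := by
    rw [hw, norm_smul, norm_inv, Real.norm_of_nonneg ht0.le, ht]
    field_simp
  -- Here `z = t • v + (1 - t) • ((t / (1 - t)) • (w - v))` and the second vector lies in the
  -- `ρ₀`-ball, so `v` in the domain would force `z` into it.
  have hcap : ∀ v, ‖v - w‖ ≤ (1 - t) * ρ₀ / 2 → v ∉ suppDom (epi (base f)) := by
    intro v hv hvd
    have hb : (t / (1 - t)) • (w - v) ∈ suppDom (epi (base f)) := by
      refine h₀ ?_
      rw [mem_ball_zero_iff, norm_smul, Real.norm_of_nonneg (by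
        exact div_nonneg ht0.le (by linarith)), norm_sub_rev]
      calc t / (1 - t) * ‖v - w‖ ≤ 1 / (1 - t) * ((1 - t) * ρ₀ / 2) := by
            have : 0 < 1 - t := by linarith
            gcongr
        _ = ρ₀ / 2 := by
            have : 1 - t ≠ 0 := by linarith
            field_simp
        _ < ρ₀ := half_lt_self hρ₀
    have := convex_suppDom _ hvd hb ht0.le (by linarith : 0 ≤ 1 - t) (by ring)
    rw [smul_smul, mul_div_cancel₀ _ (by linarith : 1 - t ≠ 0), ← smul_add, add_sub_cancel,
      hw, smul_smul, mul_inv_cancel₀ ht0.ne', one_smul] at this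
    exact hz this
  have hη : 0 < (1 - t) * ρ₀ / 2 := by
    have : 0 < 1 - t := by linarith
    positivity
  obtain ⟨L, hL⟩ := hu.exists_near hη hρ0.le
  obtain ⟨m, -, hm⟩ := hL 0
  filter_upwards [eventually_ge_atTop (m + L)] with j hj y hy
  by_contra! hyρ
  have hy0 : 0 < ‖y‖ := hρ0.trans hyρ
  have h0 : (0 : E n) ∈ suppDom (epiSeq u f j) :=
    (isLUB_avgSeq hf h₀ j 0 (by simpa using hρ₀)).bddAbove
  -- Scaled to norm `ρ`, the point is `w` itself or is reflected into the forbidden cap around `w`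
  -- by a direction used before step `j`.
  have hy' : (ρ / ‖y‖) • y ∈ suppDom (epiSeq u f j) := by
    have := convex_suppDom _ hy h0 (div_pos hρ0 hy0).le
      (sub_nonneg.2 ((div_le_one hy0).2 hyρ.le)) (by ring)
    simpa using this
  have hyn : ‖(ρ / ‖y‖) • y‖ = ρ := by
    rw [norm_smul, Real.norm_of_nonneg (div_pos hρ0 hy0).le]
    field_simp
  by_cases hyw : (ρ / ‖y‖) • y = w
  · refine hcap w (by simpa using hη.le) ?_
    rw [← hyw]
    exact suppDom_epiSeq_anti hf (Nat.zero_le j) hy'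
  · obtain ⟨i, hi, hn⟩ := hm _ w (hyn.trans hwn.symm) hyn.le hyw
    exact hcap _ hn (refl_mem_suppDom hf (suppDom_epiSeq_anti hf (by omega) hy'))

end epiSeq

/-- Separation of a convex set from the open cylinder `B(x, δ) × (-∞, T)` by a non-vertical
hyperplane. -/
lemma exists_aff_le_of_disjoint {n : ℕ} {K : Set (E n × ℝ)} (hK : Convex ℝ K) {x : E n}
    {δ T c : ℝ} (hδ : 0 < δ) (hc : ∀ p ∈ K, -p.2 ≤ c)
    (hdisj : ∀ p ∈ K, ‖p.1 - x‖ < δ → T ≤ p.2) :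
    ∃ y : E n, ∀ p ∈ K, aff y p ≤ ⟪x, y⟫_ℝ - δ / 2 * ‖y‖ - T := by
  rcases K.eq_empty_or_nonempty with rfl | ⟨p₀, hp₀⟩
  · exact ⟨0, by simp⟩
  obtain ⟨g, b, hg1, hg2⟩ := geometric_hahn_banach_open
    (s := Metric.ball x δ ×ˢ Set.Iio T) (t := K)
    ((convex_ball x δ).prod (convex_Iio T)) (Metric.isOpen_ball.prod isOpen_Iio) hK
    (Set.disjoint_left.2 fun p hp hpK => absurd (hdisj p hpK (by
      rw [← dist_eq_norm]; exact hp.1)) (not_le.2 hp.2))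
  set v : E n := (InnerProductSpace.toDual ℝ (E n)).symm
    (g.comp (ContinuousLinearMap.inl ℝ (E n) ℝ)) with hv
  set s : ℝ := g (0, 1) with hs
  have hg : ∀ z t, g (z, t) = ⟪v, z⟫_ℝ + t * s := by
    intro z t
    have e : ((z, t) : E n × ℝ) = (z, 0) + t • (0, 1) := by ext1 <;> simp
    rw [e, map_add, map_smul, hv, InnerProductSpace.toDual_symm_apply]
    simp [hs]
  -- Any fraction in `(1/2, 1)` would do: the surplus over `δ / 2` pays for the vertical case `s =
  -- 0`.
  have key : ∀ τ < T, ⟪v, x⟫_ℝ + 3 / 4 * δ * ‖v‖ + τ * s < b := by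
    intro τ hτ
    rcases eq_or_ne v 0 with h0 | h0
    · have := hg1 (x, τ) ⟨by simpa using hδ, hτ⟩
      rw [hg, h0] at this
      simpa [h0] using this
    · have hv0 : ‖v‖ ≠ 0 := norm_ne_zero_iff.2 h0
      have := hg1 (x + (3 / 4 * δ / ‖v‖) • v, τ) ⟨by
        simp only [Metric.mem_ball, dist_self_add_left, norm_smul]
        rw [Real.norm_of_nonneg (by positivity), div_mul_cancel₀ _ hv0]
        linarith, hτ⟩
      rw [hg, inner_add_right, inner_smul_right, real_inner_self_eq_norm_sq] at this
      convert this using 3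
      field_simp
  have hs0 : 0 ≤ s := by
    by_contra! hneg
    set A := ⟪v, x⟫_ℝ + 3 / 4 * δ * ‖v‖ with hA
    have := key (min (T - 1) ((b - A) / s)) (by
      exact lt_of_le_of_lt (min_le_left _ _) (by linarith))
    have h2 : (b - A) / s * s ≤ min (T - 1) ((b - A) / s) * s :=
      mul_le_mul_of_nonpos_right (min_le_right _ _) hneg.le
    rw [div_mul_cancel₀ _ hneg.ne] at h2
    linarith
  have key' : ⟪v, x⟫_ℝ + 3 / 4 * δ * ‖v‖ + T * s ≤ b := by
    have ht : Tendsto (fun τ : ℝ => ⟪v, x⟫_ℝ + 3 / 4 * δ * ‖v‖ + τ * s) (𝓝[<] T)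
        (𝓝 (⟪v, x⟫_ℝ + 3 / 4 * δ * ‖v‖ + T * s)) :=
      (Continuous.tendsto (by fun_prop) T).mono_left nhdsWithin_le_nhds
    exact le_of_tendsto ht (eventually_nhdsWithin_of_forall fun τ hτ => (key τ hτ).le)
  have hK' : ∀ p ∈ K, b ≤ ⟪v, p.1⟫_ℝ + p.2 * s := fun p hp => by
    rw [← hg]; exact hg2 p hp
  have hδv : 0 ≤ δ * ‖v‖ := by positivity
  rcases hs0.lt_or_eq with hs0 | hs0
  · refine ⟨-(s⁻¹ • v), fun p hp => ?_⟩
    have h1 := hK' p hp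
    simp only [aff, inner_neg_right, inner_smul_right, norm_neg, norm_smul, norm_inv]
    rw [Real.norm_of_nonneg hs0.le, real_inner_comm, real_inner_comm v x]
    have h2 : 0 ≤ s⁻¹ * (⟪v, p.1⟫_ℝ + p.2 * s - (⟪v, x⟫_ℝ + δ / 2 * ‖v‖ + T * s)) :=
      mul_nonneg (inv_nonneg.2 hs0.le) (by linarith)
    have h3 : s⁻¹ * (⟪v, p.1⟫_ℝ + p.2 * s - (⟪v, x⟫_ℝ + δ / 2 * ‖v‖ + T * s)) =
        s⁻¹ * ⟪v, p.1⟫_ℝ + p.2 - s⁻¹ * ⟪v, x⟫_ℝ - δ / 2 * (s⁻¹ * ‖v‖) - T := by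
      field_simp
      ring
    linarith
  · have hv0 : v ≠ 0 := by
      intro h0
      have h1 := hK' p₀ hp₀
      have h2 := key (T - 1) (by linarith)
      rw [h0, ← hs0] at h1 h2
      simp at h1 h2
      linarith
    have hvn : 0 < ‖v‖ := norm_pos_iff.2 hv0
    -- The hyperplane is vertical: a multiple of `v` is tilted by the lower bound `-c` on heights,
    -- with `l` making the surplus `l * δ * ‖v‖ / 4` equal to `|c + T|`.
    set l := 4 * |c + T| / (δ * ‖v‖) with hl
    have hl0 : 0 ≤ l := by positivity
    refine ⟨-(l • v), fun p hp => ?_⟩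
    have h1 := mul_le_mul_of_nonneg_left (key'.trans (hK' p hp)) hl0
    rw [← hs0] at h1
    have h2 : l * (δ * ‖v‖) = 4 * |c + T| := div_mul_cancel₀ _ (by positivity)
    have h3 := le_abs_self (c + T)
    have h4 := hc p hp
    simp only [aff, inner_neg_right, inner_smul_right, norm_neg, norm_smul]
    rw [Real.norm_of_nonneg hl0, real_inner_comm, real_inner_comm v x]
    linarith

/-- Choice of radii: either all balls are contained in `D`, or there are a ball in `D` and a
ball not contained in `D` whose radii have ratio close to one. -/
lemma exists_radii {n : ℕ} {D : Set (E n)} {ρ₀ δ Q : ℝ} (hρ₀ : 0 < ρ₀)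
    (h₀ : Metric.ball 0 ρ₀ ⊆ D) (hδ : 0 < δ) (hQ : 0 ≤ Q) :
    ∃ ρ r t : ℝ, 0 < ρ ∧ ρ < r ∧ Metric.ball 0 r ⊆ D ∧ 0 ≤ t ∧ (1 - t) * Q < δ * ρ ∧
      (t = 0 ∨ ∃ ρ', 0 < ρ' ∧ ¬ Metric.ball 0 ρ' ⊆ D ∧ t * ρ' ≤ ρ) := by
  by_cases hall : ∀ r, Metric.ball 0 r ⊆ D
  · refine ⟨(Q + 1) / δ, (Q + 1) / δ + 1, 0, by positivity, by linarith, hall _, le_rfl, ?_,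
      Or.inl rfl⟩
    rw [mul_div_cancel₀ _ hδ.ne']
    linarith
  push Not at hall
  obtain ⟨R, hR⟩ := hall
  set S := {r : ℝ | Metric.ball 0 r ⊆ D} with hS
  have hbdd : BddAbove S := ⟨R, fun r hr => by
    by_contra! h
    exact hR ((Metric.ball_subset_ball h.le).trans hr)⟩
  have hne : S.Nonempty := ⟨ρ₀, h₀⟩
  set r := sSup S with hr
  have hr0 : 0 < r := hρ₀.trans_le (le_csSup hbdd h₀)
  -- The radii `r(1 - η)` and `r(1 + η)` straddle the critical radius; their ratio `t` has `1 - t =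
  -- 2η / (1 + η)`.
  set η := min (1 / 2) (δ * r / (4 * (Q + 1))) with hη
  have hη0 : 0 < η := lt_min (by norm_num) (by positivity)
  have hη1 : η ≤ 1 / 2 := min_le_left _ _
  have hη2 : η * (4 * (Q + 1)) ≤ δ * r := by
    rw [← le_div_iff₀ (by positivity)]
    exact min_le_right _ _
  obtain ⟨r₁, hr₁, hlt⟩ := exists_lt_of_lt_csSup hne (show r * (1 - η) < r by nlinarith)
  refine ⟨r * (1 - η), r₁, (1 - η) / (1 + η), mul_pos hr0 (by linarith), hlt, hr₁,
    div_nonneg (by linarith) (by linarith), ?_, Or.inr ⟨r * (1 + η), by positivity, fun h => ?_, ?_⟩⟩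
  · have h1 : 1 - (1 - η) / (1 + η) = 2 * η / (1 + η) := by
      field_simp
      ring
    rw [h1, div_mul_eq_mul_div, div_lt_iff₀ (by linarith)]
    have h2 : δ * r * (1 / 2) ≤ δ * r * (1 - η) :=
      mul_le_mul_of_nonneg_left (by linarith) (by positivity)
    have h3 : 0 ≤ δ * r * (1 - η) * η := by
      have : 0 ≤ 1 - η := by linarith
      positivity
    linarith
  · have := le_csSup hbdd h
    nlinarith
  · apply le_of_eq
    field_simp

/-! ### Existence of hypo-symmetrizations -/

lemma base_exp_neg {n : ℕ} (φ : E n → EReal) : base (fun x => EReal.exp (-φ x)) = φ := by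
  funext x; simp [base]

lemma IsLCc.isConvC_base {n : ℕ} {f : E n → ℝ≥0∞} (hf : IsLCc f) : IsConvC (base f) := by
  obtain ⟨-, ψ, hψ, he⟩ := hf
  rwa [show f = fun x => EReal.exp (-ψ x) from funext he, base_exp_neg]

lemma IsLCc.base_ne_bot {n : ℕ} {f : E n → ℝ≥0∞} (hf : IsLCc f) (x : E n) : base f x ≠ ⊥ := by
  rw [base, Ne, EReal.neg_eq_bot_iff, ENNReal.log_eq_top_iff]
  exact hf.1 x

lemma IsConvC.exists_mem_epi {n : ℕ} {ψ : E n → EReal} (h : IsConvC ψ) : (epi ψ).Nonempty := by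
  obtain ⟨x, hx⟩ := h.proper
  obtain ⟨t, ht, -⟩ := EReal.lt_iff_exists_real_btwn.1 hx
  exact ⟨(x, t), ht.le⟩

/-- The conjugate of a coercive convex function is finite near the origin. -/
lemma IsConvC.exists_ball_subset_suppDom {n : ℕ} {ψ : E n → EReal} (h : IsConvC ψ)
    (hbot : ∀ x, ψ x ≠ ⊥) : ∃ ρ > 0, Metric.ball 0 ρ ⊆ suppDom (epi ψ) := by
  obtain ⟨⟨x₀, T⟩, h₀⟩ := h.exists_mem_epi
  have hco := h.coercive.eventually_const_lt (EReal.coe_lt_top (T + 1))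
  obtain ⟨R₀, -, hR₀⟩ :=
    (Metric.hasBasis_cobounded_compl_closedBall x₀).eventually_iff.1 hco
  set R := max R₀ 0 + 1 with hR
  have hRpos : 0 < R := by positivity
  have hfar : ∀ x, R ≤ ‖x - x₀‖ → ((T + 1 : ℝ) : EReal) < ψ x := by
    intro x hx
    refine hR₀ ?_
    simp only [Set.mem_compl_iff, Metric.mem_closedBall, dist_eq_norm, not_le]
    linarith [le_max_left R₀ 0]
  obtain ⟨z, -, hz⟩ := LowerSemicontinuousOn.exists_isMinOn
    (s := Metric.closedBall x₀ R) ⟨x₀, by simpa using hRpos.le⟩ (isCompact_closedBall _ _)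
    (h.lsc.lowerSemicontinuousOn _)
  obtain ⟨B, -, hB⟩ := EReal.lt_iff_exists_real_btwn.1 (bot_lt_iff_ne_bot.2 (hbot z))
  refine ⟨1 / R, by positivity, fun y hy => mem_suppDom_iff.2
    ⟨(‖x₀‖ + R) * (1 / R) + |B| + |T|, ?_⟩⟩
  rintro ⟨x, t⟩ hp
  rw [mem_ball_zero_iff] at hy
  simp only [aff]
  have hB' := neg_abs_le B
  have hT' := neg_abs_le T
  rcases le_or_gt ‖x - x₀‖ R with hx | hx
  · have h1 : B ≤ t := by
      refine EReal.coe_le_coe_iff.1 (hB.le.trans ((hz ?_).trans hp))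
      simpa [dist_eq_norm] using hx
    have h2 : ‖x‖ ≤ ‖x₀‖ + R := by
      have := norm_add_le x₀ (x - x₀)
      rw [add_sub_cancel] at this
      linarith
    have h3 : ⟪x, y⟫_ℝ ≤ (‖x₀‖ + R) * (1 / R) :=
      (real_inner_le_norm x y).trans (mul_le_mul h2 hy.le (norm_nonneg _) (by positivity))
    linarith [abs_nonneg T]
  · have hx0 : 0 < ‖x - x₀‖ := hRpos.trans hx
    set l := R / ‖x - x₀‖ with hl
    have hl0 : 0 < l := div_pos hRpos hx0
    have hl1 : l ≤ 1 := (div_le_one hx0).2 hx.le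
    -- On the sphere of radius `R` about `x₀` the function exceeds `T + 1`, so by convexity it grows
    -- at rate at least `1 / R` beyond; slopes shorter than `1 / R` are therefore dominated.
    have hw := h.convex hp h₀ hl0.le (sub_nonneg.2 hl1) (by ring)
    have hw2 := hfar (l • x + (1 - l) • x₀) (by
      rw [show l • x + (1 - l) • x₀ - x₀ = l • (x - x₀) by module, norm_smul,
        Real.norm_of_nonneg hl0.le, hl, div_mul_cancel₀ _ hx0.ne'])
    have hw3 : T + 1 < l * t + (1 - l) * T := EReal.coe_lt_coe_iff.1 (hw2.trans_le hw)
    have h1 : ‖x - x₀‖ * (1 / R) ≤ t - T := by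
      have h5 : 1 ≤ l * (t - T) := by linarith
      rw [hl, div_mul_eq_mul_div, le_div_iff₀ hx0] at h5
      rw [mul_one_div, div_le_iff₀ hRpos]
      linarith
    have h2 : ⟪x, y⟫_ℝ ≤ ‖x₀‖ * (1 / R) + ‖x - x₀‖ * (1 / R) := by
      have e : ⟪x, y⟫_ℝ = ⟪x₀, y⟫_ℝ + ⟪x - x₀, y⟫_ℝ := by rw [← inner_add_left, add_sub_cancel]
      rw [e]
      exact add_le_add
        ((real_inner_le_norm _ _).trans (mul_le_mul_of_nonneg_left hy.le (norm_nonneg _)))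
        ((real_inner_le_norm _ _).trans (mul_le_mul_of_nonneg_left hy.le (norm_nonneg _)))
    have h3 : 0 ≤ R * (1 / R) := by positivity
    linarith [abs_nonneg B]

/-- The conjugate of a function `b` given on a set `U`. -/
noncomputable def conjOn {n : ℕ} (U : Set (E n)) (b : E n → ℝ) (x : E n) : EReal :=
  ⨆ y ∈ U, ((⟪x, y⟫_ℝ - b y : ℝ) : EReal)

lemma conjOn_le_coe_iff {n : ℕ} {U : Set (E n)} {b : E n → ℝ} {x : E n} {t : ℝ} :
    conjOn U b x ≤ (t : EReal) ↔ ∀ y ∈ U, ⟪x, y⟫_ℝ - b y ≤ t := by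
  simp only [conjOn, iSup_le_iff, EReal.coe_le_coe_iff]

lemma le_conjOn {n : ℕ} {U : Set (E n)} {b : E n → ℝ} (x : E n) {y : E n} (hy : y ∈ U) :
    ((⟪x, y⟫_ℝ - b y : ℝ) : EReal) ≤ conjOn U b x :=
  le_iSup₂ (f := fun y (_ : y ∈ U) => ((⟪x, y⟫_ℝ - b y : ℝ) : EReal)) y hy

/-- Testing `y` parallel to `x` on the `ρ`-sphere gives growth `ρ‖x‖ - C`; the lower bound `c` makes
the value at `0` finite. -/
lemma isConvC_conjOn {n : ℕ} {U : Set (E n)} {b : E n → ℝ} {ρ C c : ℝ} (hρ : 0 < ρ)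
    (h1 : ∀ y, ‖y‖ = ρ → y ∈ U ∧ b y ≤ C) (h2 : ∀ y ∈ U, c ≤ b y) : IsConvC (conjOn U b) where
  convex := by
    intro p hp q hq s t hs ht hst
    simp only [epi, Set.mem_ofPred_eq, conjOn_le_coe_iff] at hp hq ⊢
    intro y hy
    have e1 := mul_le_mul_of_nonneg_left (hp y hy) hs
    have e2 := mul_le_mul_of_nonneg_left (hq y hy) ht
    have e3 : b y = s * b y + t * b y := by rw [← add_mul, hst, one_mul]
    simp only [Prod.fst_add, Prod.smul_fst, Prod.snd_add, Prod.smul_snd, smul_eq_mul,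
      inner_add_left, real_inner_smul_left]
    linarith
  coercive := by
    rw [EReal.tendsto_nhds_top_iff_real]
    intro M
    have hlim := (tendsto_norm_cobounded_atTop (E := E n)).eventually_gt_atTop
      (max 0 ((M + C) / ρ))
    filter_upwards [hlim] with x hx
    have hx0 : 0 < ‖x‖ := (le_max_left _ _).trans_lt hx
    have hx1 : M + C < ‖x‖ * ρ := (div_lt_iff₀ hρ).1 ((le_max_right _ _).trans_lt hx)
    obtain ⟨hU, hC⟩ := h1 ((ρ / ‖x‖) • x) (by
      rw [norm_smul, Real.norm_of_nonneg (by positivity), div_mul_cancel₀ _ hx0.ne'])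
    refine lt_of_lt_of_le (EReal.coe_lt_coe_iff.2 ?_) (le_conjOn x hU)
    have e : ⟪x, (ρ / ‖x‖) • x⟫_ℝ = ‖x‖ * ρ := by
      rw [inner_smul_right, real_inner_self_eq_norm_sq]
      field_simp
    rw [e]
    linarith
  proper := by
    refine ⟨0, lt_of_le_of_lt ((conjOn_le_coe_iff (t := -c)).2 fun y hy => ?_) (EReal.coe_lt_top _)⟩
    rw [inner_zero_left]
    linarith [h2 y hy]
  lsc := by
    refine lowerSemicontinuous_iSup fun y => lowerSemicontinuous_iSup fun _ => ?_
    exact (continuous_coe_real_ereal.comp (by fun_prop)).lowerSemicontinuous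

/-- Diagonal choice: at index `j`, take a witness for the largest feasible `k ≤ j`. -/
lemma exists_seq_of_eventually_exists {α : Type*} [Nonempty α] {P : ℕ → ℕ → α → Prop}
    (hmono : ∀ k k' j z, k ≤ k' → P k' j z → P k j z) (h : ∀ k, ∀ᶠ j in atTop, ∃ z, P k j z) :
    ∃ s : ℕ → α, ∀ k, ∀ᶠ j in atTop, P k j (s j) := by
  classical
  let κ : ℕ → ℕ := fun j => Nat.findGreatest (fun k => ∃ z, P k j z) j
  refine ⟨fun j => Classical.epsilon (P (κ j) j), fun k => ?_⟩
  filter_upwards [h k, eventually_ge_atTop k] with j hj hjk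
  exact hmono k (κ j) j _ (Nat.le_findGreatest hjk hj)
    (Classical.epsilon_spec (Nat.findGreatest_spec (P := fun k => ∃ z, P k j z) hjk hj))

/-! ### The radial limit and epi-convergence to its conjugate -/

section limit

variable {n : ℕ} {u : ℕ → E n} {f : E n → ℝ≥0∞} {b : E n → ℝ}

/-- The union of all centred open balls contained in the domain of the support function. -/
def innerBall (f : E n → ℝ≥0∞) : Set (E n) :=
  {y | ∃ r, ‖y‖ < r ∧ Metric.ball 0 r ⊆ suppDom (epi (base f))}

lemma continuousOn_supp (hf : (epi (base f)).Nonempty) {ρ r : ℝ} (hρ : ρ < r)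
    (hr : Metric.ball 0 r ⊆ suppDom (epi (base f))) :
    ContinuousOn (supp (epi (base f))) (Metric.closedBall 0 ρ) :=
  (((convexOn_supp hf).subset hr (convex_ball _ _)).continuousOn Metric.isOpen_ball).mono
    (Metric.closedBall_subset_ball hρ)

/-- `b` is the pointwise limit of the averaged support functions on `innerBall f`. -/
def IsAvgLimit (u : ℕ → E n) (f : E n → ℝ≥0∞) (b : E n → ℝ) : Prop :=
  ∀ y ∈ innerBall f, Tendsto (fun m => avgSeq u (supp (epi (base f))) m y) atTop (𝓝 (b y))

lemma exists_isAvgLimit (hu : IsRichSeq u) (hf : (epi (base f)).Nonempty) :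
    ∃ b, IsAvgLimit u f b := by
  have : ∀ y : E n, ∃ c, y ∈ innerBall f →
      Tendsto (fun m => avgSeq u (supp (epi (base f))) m y) atTop (𝓝 c) := by
    intro y
    by_cases hy : y ∈ innerBall f
    · obtain ⟨r, hr1, hr2⟩ := hy
      obtain ⟨c, hc⟩ := exists_tendsto_avgSeq hu (continuousOn_supp hf hr1 hr2)
      exact ⟨c, fun _ => hc⟩
    · exact ⟨0, fun h => absurd h hy⟩
  choose b hb using this
  exact ⟨b, hb⟩

lemma IsAvgLimit.eventually_abs_sub_le (hb : IsAvgLimit u f b) (hu : IsRichSeq u)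
    (hf : (epi (base f)).Nonempty) {ρ r ε : ℝ} (h0 : 0 ≤ ρ) (hρ : ρ < r)
    (hr : Metric.ball 0 r ⊆ suppDom (epi (base f))) (hε : 0 < ε) :
    ∀ᶠ m in atTop, ∀ y, ‖y‖ ≤ ρ → |b y - avgSeq u (supp (epi (base f))) m y| ≤ ε := by
  filter_upwards [eventually_oscLe hu h0 (continuousOn_supp hf hρ hr) hε] with m hm y hy
  have ht := ((hb y ⟨r, hy.trans_lt hρ, hr⟩).sub_const
    (avgSeq u (supp (epi (base f))) m y)).abs
  exact le_of_tendsto ht (by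
    filter_upwards [eventually_ge_atTop m] with j hj using hm.sub_le hj hy)

lemma IsAvgLimit.eq_of_norm_eq (hb : IsAvgLimit u f b) (hu : IsRichSeq u)
    (hf : (epi (base f)).Nonempty) {x y : E n} (hx : x ∈ innerBall f) (hxy : ‖x‖ = ‖y‖) :
    b x = b y := by
  have key : ∀ x y : E n, x ∈ innerBall f → ‖x‖ = ‖y‖ → b x ≤ b y := by
    intro x y hx hxy
    have hy : y ∈ innerBall f := by simpa [innerBall, hxy] using hx
    obtain ⟨r, hr1, hr2⟩ := id hx
    refine le_of_forall_pos_le_add fun ε hε => ?_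
    have ht := (hb x hx).sub (hb y hy)
    have := le_of_tendsto ht (by
      filter_upwards [eventually_oscLe hu (norm_nonneg x) (continuousOn_supp hf hr1 hr2) hε]
        with m hm using hm x y hxy le_rfl)
    linarith
  refine le_antisymm (key x y hx hxy) (key y x ?_ hxy.symm)
  simpa [innerBall, hxy] using hx

lemma zero_mem_innerBall {ρ₀ : ℝ} (hρ₀ : 0 < ρ₀)
    (h₀ : Metric.ball 0 ρ₀ ⊆ suppDom (epi (base f))) : (0 : E n) ∈ innerBall f :=
  ⟨ρ₀, by simpa using hρ₀, h₀⟩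

lemma IsAvgLimit.apply_zero (hb : IsAvgLimit u f b) (h0 : (0 : E n) ∈ innerBall f) :
    b 0 = supp (epi (base f)) 0 := by
  have := hb 0 h0
  simp only [avgSeq_zero_apply] at this
  exact tendsto_nhds_unique this tendsto_const_nhds

/-- Midpoint convexity between `y` and `-y` holds for each average, the value at `0` never changes,
and `b y = b (-y)` in the limit. -/
lemma IsAvgLimit.supp_zero_le (hb : IsAvgLimit u f b) (hu : IsRichSeq u)
    (hf : (epi (base f)).Nonempty) {y : E n} (hy : y ∈ innerBall f) :
    supp (epi (base f)) 0 ≤ b y := by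
  obtain ⟨r, hr1, hr2⟩ := id hy
  have hy' : -y ∈ innerBall f := by simpa [innerBall] using hy
  have h1 := hb.eq_of_norm_eq hu hf hy (norm_neg y).symm
  have ht := (hb y hy).add (hb (-y) hy')
  have h2 := ge_of_tendsto' (b := 2 * supp (epi (base f)) 0) ht fun m => by
    have l1 := isLUB_avgSeq (u := u) hf hr2 m y hr1
    have l2 := isLUB_avgSeq (u := u) hf hr2 m (-y) (by rwa [norm_neg])
    have l3 := isLUB_avgSeq (u := u) hf hr2 m 0 (by
      rw [norm_zero]; exact (norm_nonneg y).trans_lt hr1)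
    rw [avgSeq_zero_apply] at l3
    have : supp (epi (base f)) 0 ≤ (avgSeq u (supp (epi (base f))) m y +
        avgSeq u (supp (epi (base f))) m (-y)) / 2 := by
      refine l3.2 ?_
      rintro _ ⟨p, hp, rfl⟩
      have e1 := l1.1 ⟨p, hp, rfl⟩
      have e2 := l2.1 ⟨p, hp, rfl⟩
      simp only [aff, inner_neg_right, inner_zero_right] at e1 e2 ⊢
      linarith
    linarith
  linarith

lemma le_base_iterSym (hf : (epi (base f)).Nonempty) {y : E n} (hy : y ∈ innerBall f) (m : ℕ)
    (z : E n) : ((⟪z, y⟫_ℝ - avgSeq u (supp (epi (base f))) m y : ℝ) : EReal) ≤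
      base (iterSym u f m) z := by
  obtain ⟨r, hr1, hr2⟩ := hy
  refine EReal.le_of_forall_lt_iff_le.1 fun t ht => EReal.coe_le_coe_iff.2 ?_
  have h1 : aff y (z, t) ≤ _ :=
    (isLUB_avgSeq (u := u) hf hr2 m y hr1).1 ⟨_, mem_epiSeq_of_lt u f m z t ht, rfl⟩
  simp only [aff] at h1
  linarith

lemma IsAvgLimit.conjOn_le_liminf (hb : IsAvgLimit u f b) (hf : (epi (base f)).Nonempty)
    {x : E n} {s : ℕ → E n} (hs : Tendsto s atTop (𝓝 x)) :
    conjOn (innerBall f) b x ≤ liminf (fun j => base (iterSym u f j) (s j)) atTop := by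
  refine iSup₂_le fun y hy => ?_
  have ht : Tendsto (fun j => ((⟪s j, y⟫_ℝ - avgSeq u (supp (epi (base f))) j y : ℝ) : EReal))
      atTop (𝓝 ((⟪x, y⟫_ℝ - b y : ℝ) : EReal)) :=
    EReal.tendsto_coe.2 ((hs.inner tendsto_const_nhds).sub (hb y hy))
  rw [← ht.liminf_eq]
  exact liminf_le_liminf (Eventually.of_forall fun j => le_base_iterSym hf hy j (s j))

/-- Otherwise a slope `y` separates the epigraph from the cylinder with gain `δ / 2 * ‖y‖`. Inside
the `ρ`-ball this contradicts convergence to `b`. Outside, interpolating with the slope `0` down to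
norm `ρ` costs at most `(1 - t) * (v + c)`, less than the gain `δ / 2 * ρ`. -/
lemma IsAvgLimit.eventually_exists_mem (hb : IsAvgLimit u f b) (hu : IsRichSeq u)
    (hf : (epi (base f)).Nonempty) (hconv : Convex ℝ (epi (base f))) {ρ₀ : ℝ} (hρ₀ : 0 < ρ₀)
    (h₀ : Metric.ball 0 ρ₀ ⊆ suppDom (epi (base f))) {x : E n} {v : ℝ}
    (hv : ∀ y ∈ innerBall f, ⟪x, y⟫_ℝ - b y ≤ v) {δ ε : ℝ} (hδ : 0 < δ) (hε : 0 < ε) :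
    ∀ᶠ j in atTop, ∃ p ∈ epiSeq u f j, ‖p.1 - x‖ < δ ∧ p.2 < v + ε := by
  set c := supp (epi (base f)) 0 with hc
  have hz := zero_mem_innerBall hρ₀ h₀
  have hQ : 0 ≤ v + c := by
    have := hv 0 hz
    rw [hb.apply_zero hz, inner_zero_right] at this
    linarith
  obtain ⟨ρ, r, t, hρ, hρr, hr, ht0, htQ, hcase⟩ := exists_radii hρ₀ h₀ (half_pos hδ) hQ
  have hdom : ∀ᶠ j in atTop, ∀ y ∈ suppDom (epiSeq u f j), t * ‖y‖ ≤ ρ := by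
    rcases hcase with rfl | ⟨ρ', -, hρ', hle⟩
    · exact Eventually.of_forall fun j y _ => by simpa using hρ.le
    · filter_upwards [eventually_suppDom_subset hu hf hρ₀ h₀ hρ'] with j hj y hy
      exact (mul_le_mul_of_nonneg_left (hj y hy) ht0).trans hle
  -- The net gain for long slopes; half of it is the permitted error of the averages.
  set κ := δ / 2 * ρ - (1 - t) * (v + c) with hκ
  have hκ0 : 0 < κ := by linarith
  filter_upwards [hdom, hb.eventually_abs_sub_le hu hf hρ.le hρr hr
    (lt_min (half_pos hε) (half_pos hκ0))] with j hj1 hj2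
  by_contra! hcon
  have hcj : ∀ p ∈ epiSeq u f j, -p.2 ≤ c := by
    intro p hp
    have := (isLUB_avgSeq (u := u) hf h₀ j 0 (by simpa using hρ₀)).1 ⟨p, hp, rfl⟩
    rw [avgSeq_zero_apply] at this
    simpa [aff] using this
  obtain ⟨y, hy⟩ := exists_aff_le_of_disjoint (convex_epiSeq hconv j) hδ hcj hcon
  have hyd : y ∈ suppDom (epiSeq u f j) := mem_suppDom_iff.2 ⟨_, hy⟩
  rcases le_or_gt ‖y‖ ρ with hyρ | hyρ
  · have h1 : avgSeq u (supp (epi (base f))) j y ≤ ⟪x, y⟫_ℝ - δ / 2 * ‖y‖ - (v + ε) := by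
      refine (isLUB_avgSeq hf hr j y (hyρ.trans_lt hρr)).2 ?_
      rintro _ ⟨p, hp, rfl⟩
      exact hy p hp
    have h2 := (abs_le.1 ((hj2 y hyρ).trans (min_le_left _ _))).2
    have h3 := hv y ⟨r, hyρ.trans_lt hρr, hr⟩
    have h4 : 0 ≤ δ / 2 * ‖y‖ := by positivity
    linarith
  · have hy0 : 0 < ‖y‖ := hρ.trans hyρ
    set l := ρ / ‖y‖ with hl
    have hl0 : 0 < l := div_pos hρ hy0
    have hl1 : l ≤ 1 := (div_le_one hy0).2 hyρ.le
    have hly : l * ‖y‖ = ρ := div_mul_cancel₀ _ hy0.ne'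
    have hwn : ‖l • y‖ = ρ := by rw [norm_smul, Real.norm_of_nonneg hl0.le, hly]
    have h1 : avgSeq u (supp (epi (base f))) j (l • y) ≤
        l * (⟪x, y⟫_ℝ - δ / 2 * ‖y‖ - (v + ε)) + (1 - l) * c := by
      refine (isLUB_avgSeq hf hr j _ (hwn.trans_lt hρr)).2 ?_
      rintro _ ⟨p, hp, rfl⟩
      have e := aff_combo y 0 p (show l + (1 - l) = 1 by ring)
      rw [smul_zero, add_zero] at e
      rw [e]
      refine add_le_add (mul_le_mul_of_nonneg_left (hy p hp) hl0.le)
        (mul_le_mul_of_nonneg_left ?_ (sub_nonneg.2 hl1))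
      simpa [aff] using hcj p hp
    have h2 := (abs_le.1 ((hj2 _ hwn.le).trans (min_le_right _ _))).2
    have h3 := hv (l • y) ⟨r, hwn.trans_lt hρr, hr⟩
    rw [inner_smul_right] at h3
    have h4 : t ≤ l := (le_div_iff₀ hy0).2 (hj1 y hyd)
    have h5 : (1 - l) * (v + c) ≤ (1 - t) * (v + c) :=
      mul_le_mul_of_nonneg_right (by linarith) hQ
    have h6 : l * (δ / 2 * ‖y‖) = δ / 2 * ρ := by rw [← hly]; ring
    have h7 : 0 ≤ l * ε := by positivity
    linarith

lemma IsAvgLimit.epiConverges (hb : IsAvgLimit u f b) (hu : IsRichSeq u)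
    (hf : (epi (base f)).Nonempty) (hconv : Convex ℝ (epi (base f))) {ρ₀ : ℝ} (hρ₀ : 0 < ρ₀)
    (h₀ : Metric.ball 0 ρ₀ ⊆ suppDom (epi (base f))) :
    EpiConverges (fun j => base (iterSym u f j)) (conjOn (innerBall f) b) := by
  intro x
  refine ⟨fun s hs => hb.conjOn_le_liminf hf hs, ?_⟩
  suffices h : ∃ s : ℕ → E n, Tendsto s atTop (𝓝 x) ∧
      limsup (fun j => base (iterSym u f j) (s j)) atTop ≤ conjOn (innerBall f) b x by
    obtain ⟨s, hs, hlim⟩ := h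
    exact ⟨s, hs, tendsto_of_le_liminf_of_limsup_le (hb.conjOn_le_liminf hf hs) hlim⟩
  rcases eq_or_ne (conjOn (innerBall f) b x) ⊤ with htop | htop
  -- At an infinite value every convergent sequence recovers.
  · exact ⟨fun _ => x, tendsto_const_nhds, by rw [htop]; exact le_top⟩
  have hbot : conjOn (innerBall f) b x ≠ ⊥ := ne_bot_of_le_ne_bot (EReal.coe_ne_bot _)
    (le_conjOn x (zero_mem_innerBall hρ₀ h₀))
  obtain ⟨v, hv⟩ : ∃ v : ℝ, (v : EReal) = conjOn (innerBall f) b x :=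
    ⟨_, EReal.coe_toReal htop hbot⟩
  have hv' := conjOn_le_coe_iff.1 hv.ge
  obtain ⟨s, hs⟩ := exists_seq_of_eventually_exists
    (P := fun k j z => ‖z - x‖ < 1 / ((k : ℝ) + 1) ∧
      base (iterSym u f j) z ≤ ((v + 1 / ((k : ℝ) + 1) : ℝ) : EReal))
    (fun k k' j z hk h => by
      have hle : 1 / ((k' : ℝ) + 1) ≤ 1 / ((k : ℝ) + 1) := one_div_le_one_div_of_le
        (by positivity) (by exact_mod_cast Nat.succ_le_succ hk)
      exact ⟨h.1.trans_le hle, h.2.trans (EReal.coe_le_coe_iff.2 (by linarith))⟩)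
    (fun k => by
      filter_upwards [hb.eventually_exists_mem hu hf hconv hρ₀ h₀ hv'
        (Nat.one_div_pos_of_nat (n := k) (α := ℝ)) (Nat.one_div_pos_of_nat (n := k) (α := ℝ))]
        with j hj
      obtain ⟨p, hp, hp1, hp2⟩ := hj
      exact ⟨p.1, hp1, (epiSeq_subset u f j hp).trans (EReal.coe_le_coe_iff.2 hp2.le)⟩)
  refine ⟨s, ?_, ?_⟩
  · rw [tendsto_iff_norm_sub_tendsto_zero, Metric.tendsto_atTop']
    intro ε hε
    obtain ⟨k, hk⟩ := exists_nat_one_div_lt hε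
    obtain ⟨N, hN⟩ := eventually_atTop.1 (hs k)
    refine ⟨N, fun j hj => ?_⟩
    rw [Real.dist_0_eq_abs, abs_norm]
    exact (hN j hj.le).1.trans hk
  · rw [← hv]
    refine EReal.le_of_forall_lt_iff_le.1 fun t ht => ?_
    obtain ⟨k, hk⟩ := exists_nat_one_div_lt (sub_pos.2 (EReal.coe_lt_coe_iff.1 ht))
    refine limsup_le_of_le (by isBoundedDefault) ?_
    filter_upwards [hs k] with j hj
    exact hj.2.trans (EReal.coe_le_coe_iff.2 (by linarith))

end limit

theorem exists_isHypoSymmetrization {n : ℕ} (hn : 1 ≤ n) {f : E n → ℝ≥0∞} (hf : IsLCc f) :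
    ∃ g, IsHypoSymmetrization f g := by
  have hc := hf.isConvC_base
  have hne := hc.exists_mem_epi
  obtain ⟨ρ₀, hρ₀, h₀⟩ := hc.exists_ball_subset_suppDom hf.base_ne_bot
  obtain ⟨u, hu⟩ := exists_isRichSeq hn
  obtain ⟨b, hb⟩ := exists_isAvgLimit hu hne
  have : Nonempty (Fin n) := ⟨⟨0, hn⟩⟩
  obtain ⟨y₀, hy₀⟩ := NormedSpace.sphere_nonempty (x := (0 : E n)).2 (half_pos hρ₀).le
  rw [mem_sphere_zero_iff_norm] at hy₀
  have hin : ∀ y : E n, ‖y‖ = ρ₀ / 2 → y ∈ innerBall f := fun y hy =>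
    ⟨ρ₀, hy.trans_lt (half_lt_self hρ₀), h₀⟩
  have hconv : IsConvC (conjOn (innerBall f) b) := isConvC_conjOn (half_pos hρ₀)
    (fun y hy => ⟨hin y hy, (hb.eq_of_norm_eq hu hne (hin y hy) (hy.trans hy₀.symm)).le⟩)
    (fun y hy => hb.supp_zero_le hu hne hy)
  -- One inequality suffices, as it also applies to `T.symm`; it holds because `b` and `innerBall f`
  -- are radial.
  have hinv : ∀ (T : E n ≃ₗᵢ[ℝ] E n) (x : E n),
      conjOn (innerBall f) b (T x) ≤ conjOn (innerBall f) b x := by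
    intro T x
    refine iSup₂_le fun y hy => ?_
    have hy' : T.symm y ∈ innerBall f := by simpa [innerBall] using hy
    have e := hb.eq_of_norm_eq hu hne hy (T.symm.norm_map y).symm
    have e2 : ⟪T x, y⟫_ℝ = ⟪x, T.symm y⟫_ℝ := by
      rw [← T.inner_map_map x, T.apply_symm_apply]
    rw [e, e2]
    exact le_conjOn x hy'
  refine ⟨fun x => EReal.exp (-conjOn (innerBall f) b x), ⟨fun x => ?_, _, hconv, fun x => rfl⟩,
    fun T x => ?_, u, hu.norm_eq_one, ?_⟩
  · rw [Ne, EReal.exp_eq_top_iff, EReal.neg_eq_top_iff]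
    exact ne_bot_of_le_ne_bot (EReal.coe_ne_bot _) (le_conjOn x (zero_mem_innerBall hρ₀ h₀))
  · have e : conjOn (innerBall f) b (T x) = conjOn (innerBall f) b x :=
      le_antisymm (hinv T x) (by simpa using hinv T.symm (T x))
    simp only [e]
  · rw [HypoConverges, base_exp_neg]
    exact hb.epiConverges hu hne hc.convex hρ₀ h₀

end HypoSym

theorem theorem5p2 (n N : ℕ) (hn : 1 ≤ n) (hN : n + 2 ≤ N)
    (f : HypoSym.E n → ENNReal) (hf : HypoSym.IsLCc f) :
    (∃ fsym : HypoSym.E n → ENNReal, HypoSym.IsHypoSymmetrization f fsym) ∧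
    ∀ fsym : HypoSym.E n → ENNReal, HypoSym.IsHypoSymmetrization f fsym →
      HypoSym.G N f ≥ HypoSym.G N fsym := by
  refine ⟨HypoSym.exists_isHypoSymmetrization hn hf, fun fsym hsym => ?_⟩
  obtain ⟨u, -, hu⟩ := hsym.limit
  exact HypoSym.G_le_of_hypoConverges hn N hu
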